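/- Let $(E,\mathcal E,m)$ be a $\sigma$-finite measure space, $L^p=L^p(E,\mathcal E,m)$ (real-valued functions) and $L^1_+$ the cone of nonnegative elements of $L^1$. A substochastic semigroup is a strongly continuous semigroup of positive contractions on $L^1$; it is called stochastic if each of its operators maps $\{u\in L^1_+:\|u\|=1\}$ into itself. Let $(A,\mathcal D(A))$ and $(B,\mathcal D(B))$ be linear operators in $L^1$ such that $A$ is the generator of a substochastic semigroup, $\mathcal D(A)\subseteq\mathcal D(B)$, and for every $u\in\mathcal D(A)\cap L^1_+$ $$Bu\ge 0\qquad\text{and}\qquad\int_E (Au+Bu)\,dm=0 .$$ Let $\lambda>0$. Then $\lambda$ belongs to the resolvent set of $A$; with $R(\lambda,A)=(\lambda-A)^{-1}$, the everywhere defined operator $T=BR(\lambda,A)$ on $L^1$ has an adjoint $T^*\colon L^\infty\to L^\infty$, $\int_E (T^*f)\,u\,dm=\int_E f\,Tu\,dm$; and the limit $$f_\lambda(x)=\lim_{n\to\infty}(T^{*n}1)(x)$$ exists for $m$-almost every $x\in E$. Moreover, among all substochastic semigroups on $L^1$ whose generator is an extension of $(A+B,\mathcal D(A))$ there is a unique smallest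 one, $\{P(t)\}_{t\ge0}$; that is, $P(t)u\le Q(t)u$ for all $t\ge0$, $u\in L^1_+$ and every other such semigroup $\{Q(t)\}_{t\ge0}$. The following conditions are equivalent: 1. $\{P(t)\}_{t\ge0}$ is a stochastic semigroup. 2. $BR(\lambda,A)$ is mean ergodic, i.e. $\lim_{N\to\infty}\frac1N\sum_{n=0}^{N-1}(BR(\lambda,A))^n u$ exists in $L^1$ for all $u\in L^1$. 3. $m\{x\in E: f_\lambda(x)>0\}=0$. 4. There is $u\in L^1_+$ with $u>0$ a.e. such that $\lim_{n\to\infty}\|(BR(\lambda,A))^n u\|=0$. -/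

import Mathlib

open MeasureTheory Filter Topology
open scoped NNReal ENNReal

noncomputable section

namespace KatoVoigt

section Semigroups

variable {X : Type*} [NormedAddCommGroup X] [NormedSpace ℝ X]

/-- Strongly continuous (one-parameter) semigroups of bounded linear operators. -/
structure IsC0Semigroup (S : ℝ≥0 → X →L[ℝ] X) : Prop where
  map_zero : S 0 = 1
  map_add : ∀ s t, S (s + t) = S s * S t
  continuous_orbit : ∀ u, Continuous fun t => S t u

/-- The generator of a semigroup `S`: its domain consists of all `u` for which
`(S(t)u - u) / t` has a limit as `t ↓ 0`, and its value at `u` is this limit. -/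
def generator (S : ℝ≥0 → X →L[ℝ] X) : X →ₗ.[ℝ] X where
  domain :=
    { carrier := {u | ∃ v, Tendsto (fun t : ℝ≥0 => (t : ℝ)⁻¹ • (S t u - u)) (𝓝[>] 0) (𝓝 v)}
      zero_mem' := ⟨0, by simp⟩
      add_mem' := by
        rintro u u' ⟨v, hv⟩ ⟨v', hv'⟩
        refine ⟨v + v', (hv.add hv').congr fun t => ?_⟩
        rw [map_add, ← smul_add]
        congr 1
        abel
      smul_mem' := by
        rintro c u ⟨v, hv⟩
        refine ⟨c • v, (hv.const_smul c).congr fun t => ?_⟩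
        rw [map_smul, ← smul_sub, smul_comm] }
  toFun :=
    { toFun := fun u => u.2.choose
      map_add' := by
        intro u u'
        refine tendsto_nhds_unique (u + u').2.choose_spec
          ((u.2.choose_spec.add u'.2.choose_spec).congr fun t => ?_)
        rw [Submodule.coe_add, map_add, ← smul_add]
        congr 1
        abel
      map_smul' := by
        intro c u
        refine tendsto_nhds_unique (c • u).2.choose_spec
          ((u.2.choose_spec.const_smul c).congr fun t => ?_)
        rw [Submodule.coe_smul, map_smul, ← smul_sub, smul_comm] }

theorem mem_graph_generator {S : ℝ≥0 → X →L[ℝ] X} {u v : X} :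
    (u, v) ∈ (generator S).graph ↔
      Tendsto (fun t : ℝ≥0 => (t : ℝ)⁻¹ • (S t u - u)) (𝓝[>] 0) (𝓝 v) := by
  rw [LinearPMap.mem_graph_iff]
  constructor
  · rintro ⟨y, rfl, rfl⟩
    exact y.2.choose_spec
  · intro h
    exact ⟨⟨u, v, h⟩, rfl, tendsto_nhds_unique (Exists.choose_spec (⟨v, h⟩ : ∃ v, Tendsto
      (fun t : ℝ≥0 => (t : ℝ)⁻¹ • (S t u - u)) (𝓝[>] 0) (𝓝 v))) h⟩

/-- The operator `lam - A`, defined on the domain of `A`. -/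
def shift (A : X →ₗ.[ℝ] X) (lam : ℝ) : A.domain →ₗ[ℝ] X :=
  lam • A.domain.subtype - A.toFun

/-- The (real) resolvent set of `A`: all `lam` such that `lam - A : D(A) → X` is a bijection
whose inverse is a bounded operator. -/
def resolventSet (A : X →ₗ.[ℝ] X) : Set ℝ :=
  {lam | Function.Bijective (shift A lam) ∧
    ∃ R : X →L[ℝ] X, ∀ u : A.domain, R (shift A lam u) = u}

open Classical in
/-- The resolvent `R(lam, A) = (lam - A)⁻¹`, as a map of `X` onto the domain of `A`.
(The value for `lam` outside the resolvent set is irrelevant.) -/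
def resolvent (A : X →ₗ.[ℝ] X) (lam : ℝ) : X →ₗ[ℝ] A.domain :=
  if h : lam ∈ resolventSet A then
    ((LinearEquiv.ofBijective (shift A lam) h.1).symm : X →ₗ[ℝ] A.domain)
  else 0

/-- The operator `B R(lam, A)`, everywhere defined because `D(A) ⊆ D(B)`. -/
def BR (A B : X →ₗ.[ℝ] X) (hAB : A.domain ≤ B.domain) (lam : ℝ) : X →ₗ[ℝ] X :=
  B.toFun ∘ₗ Submodule.inclusion hAB ∘ₗ resolvent A lam

/-- Mean ergodicity: the averages `N⁻¹ ∑_{n < N} Tⁿ u` converge in norm for every `u`. -/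
def IsMeanErgodic (T : X →ₗ[ℝ] X) : Prop :=
  ∀ u, ∃ v, Tendsto (fun N : ℕ => (N : ℝ)⁻¹ • ∑ n ∈ Finset.range N, (T ^ n) u) atTop (𝓝 v)

end Semigroups

section L1

variable {E : Type*} [MeasurableSpace E] {m : Measure E}

/-- Densities: the nonnegative elements of `L¹` with norm one. -/
def IsDensity (u : Lp ℝ 1 m) : Prop := 0 ≤ u ∧ ‖u‖ = 1

/-- Semigroups of positive contractions on `L¹`, strongly continuous. -/
structure IsSubstochasticSemigroup (S : ℝ≥0 → Lp ℝ 1 m →L[ℝ] Lp ℝ 1 m) : Prop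
    extends IsC0Semigroup S where
  nonneg : ∀ t u, 0 ≤ u → 0 ≤ S t u
  contraction : ∀ t u, ‖S t u‖ ≤ ‖u‖

/-- Semigroups of stochastic operators on `L¹` (operators that map densities to densities),
strongly continuous. -/
structure IsStochasticSemigroup (S : ℝ≥0 → Lp ℝ 1 m →L[ℝ] Lp ℝ 1 m) : Prop
    extends IsC0Semigroup S where
  density : ∀ t u, IsDensity u → IsDensity (S t u)

/-- `P` is the smallest substochastic semigroup whose generator is an extension of
`A + B` (as an operator on `D(A) ∩ D(B)`, which is `D(A)` when `D(A) ⊆ D(B)`). -/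
structure IsMinimalSemigroup (A B : Lp ℝ 1 m →ₗ.[ℝ] Lp ℝ 1 m)
    (P : ℝ≥0 → Lp ℝ 1 m →L[ℝ] Lp ℝ 1 m) : Prop where
  substochastic : IsSubstochasticSemigroup P
  extension : A + B ≤ generator P
  le : ∀ Q : ℝ≥0 → Lp ℝ 1 m →L[ℝ] Lp ℝ 1 m, IsSubstochasticSemigroup Q →
    A + B ≤ generator Q → ∀ t u, 0 ≤ u → P t u ≤ Q t u

/-- `T'` is the adjoint of `T` with respect to the pairing of `L^∞` and `L¹`. -/
def IsAdjoint (T : Lp ℝ 1 m →ₗ[ℝ] Lp ℝ 1 m) (T' : Lp ℝ ∞ m →ₗ[ℝ] Lp ℝ ∞ m) : Prop :=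
  ∀ (f : Lp ℝ ∞ m) (u : Lp ℝ 1 m), ∫ x, T' f x * u x ∂m = ∫ x, f x * T u x ∂m

open Classical in
/-- The adjoint `T* : L^∞ → L^∞` of a bounded operator `T` on `L¹`. On a σ-finite measure space
it exists, and it is the only operator with `IsAdjoint T T*`. -/
def adjoint (T : Lp ℝ 1 m →ₗ[ℝ] Lp ℝ 1 m) : Lp ℝ ∞ m →ₗ[ℝ] Lp ℝ ∞ m :=
  if h : ∃ T', IsAdjoint T T' then h.choose else 0

/-- The constant function one in `L^∞`. -/
def oneLp (m : Measure E) : Lp ℝ ∞ m := (memLp_top_const (1 : ℝ)).toLp fun _ => (1 : ℝ)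

/-- The pointwise limit `lim_n T*ⁿ 1`. -/
def limitFunction (T : Lp ℝ 1 m →ₗ[ℝ] Lp ℝ 1 m) (x : E) : ℝ :=
  limUnder atTop fun n : ℕ => ((adjoint T) ^ n) (oneLp m) x

end L1

end KatoVoigt

end

/-! Write `R = R(lam, A)` and `T = B R`. For `x = R u` the hypothesis on the integral of `A x + B x`
reads `∫ T u = ∫ u - lam ∫ R u`. So `T` is a positive contraction, and telescoping gives `lam ∑_{n <
N} ∫ R Tⁿ u = ∫ u - ∫ T^N u` (`IsKatoPair.sum_integral_eq`). Hence `K u = ∑ R Tⁿ u` converges with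
`‖K u‖ ≤ lam⁻¹ ‖u‖`. Formally `K = R (1 - T)⁻¹ = (lam - A - B)⁻¹`. The family `K` does satisfy the
resolvent identity and `lam K → 1` (`IsKatoFamily.exists_resolvent`), so Hille–Yosida yields a
semigroup `P`.

The resolvent `L` of any competing semigroup satisfies `L = ∑_{n < N} R Tⁿ + L T^N`, hence dominates
`K` on the cone. Exponentials of Yosida approximations are power series in the resolvents with
nonnegative coefficients, up to a positive factor, so the order passes to the semigroups and `P` is
minimal (`exists_isMinimalSemigroup`).

In the limit, `lim ∫ Tⁿ u = ∫ u - lam ∫ K u`. Since `P` preserves the integral exactly when `lam K`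
does, condition 1 says that `∫ Tⁿ u → 0` for every `u`. By duality `∫ Tⁿ u = ∫ (T*ⁿ 1) u → ∫ f u`,
where `f` is the decreasing limit of `T*ⁿ 1`; this settles conditions 3 and 4. If `T` is mean
ergodic, the averages of `Tⁿ u`, `u ≥ 0`, tend to a fixed point `v ≥ 0` of `T`. Then `∫ R v = 0`, so
`R v = 0` and `v = 0`, and `∫ Tⁿ u`, which converges, has limit zero. -/

namespace KatoVoigt

/-! ### Estimates for commuting contraction semigroups -/

section Contractions

variable {X : Type*} [NormedAddCommGroup X] [NormedSpace ℝ X]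

theorem mem_graph_generator_of_hasDerivAt {S : ℝ≥0 → X →L[ℝ] X} {u v : X} {G : ℝ → X}
    (hG : HasDerivAt G v 0) (h0 : G 0 = u) (hS : ∀ t : ℝ≥0, S t u = G t) :
    (u, v) ∈ (generator S).graph := by
  rw [mem_graph_generator]
  have hc : Tendsto (fun t : ℝ≥0 => (t : ℝ)) (𝓝[>] 0) (𝓝[≠] 0) := by
    refine tendsto_nhdsWithin_iff.2 ⟨?_, ?_⟩
    · exact (NNReal.continuous_coe.tendsto' 0 0 rfl).mono_left nhdsWithin_le_nhds
    · filter_upwards [self_mem_nhdsWithin] with t ht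
      exact (NNReal.coe_pos.2 ht).ne'
  refine ((hasDerivAt_iff_tendsto_slope_zero.1 hG).comp hc).congr fun t => ?_
  simp [hS, h0]

theorem norm_pow_apply_le {C : X →L[ℝ] X} (hC : ∀ u, ‖C u‖ ≤ ‖u‖) (n : ℕ) (u : X) :
    ‖(C ^ n) u‖ ≤ ‖u‖ := by
  induction n with
  | zero => simp
  | succ n ih => rw [pow_succ', mul_apply_eq_comp]; exact (hC _).trans ih

/-- Telescoping: since `C` and `D` commute, the difference is a sum of `n` terms, each a product of
contractions applied to `C u - D u`. -/
theorem norm_pow_sub_pow_apply_le {C D : X →L[ℝ] X} (hC : ∀ u, ‖C u‖ ≤ ‖u‖)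
    (hD : ∀ u, ‖D u‖ ≤ ‖u‖) (h : Commute C D) (n : ℕ) (u : X) :
    ‖(C ^ n) u - (D ^ n) u‖ ≤ n * ‖C u - D u‖ := by
  induction n with
  | zero => simp
  | succ n ih =>
    have e : (C ^ (n + 1)) u - (D ^ (n + 1)) u
        = (C ^ n) (C u - D u) + D ((C ^ n) u - (D ^ n) u) := by
      have h1 : (C ^ n) (D u) = D ((C ^ n) u) := by
        rw [← mul_apply_eq_comp, ← mul_apply_eq_comp, (h.pow_left n).eq]
      rw [pow_succ C, pow_succ' D, mul_apply_eq_comp, mul_apply_eq_comp,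
        map_sub, map_sub, h1]
      abel
    rw [e]
    refine (norm_add_le _ _).trans ?_
    rw [Nat.cast_succ, add_mul, one_mul]
    linarith [norm_pow_apply_le hC n (C u - D u), hD ((C ^ n) u - (D ^ n) u)]

theorem IsC0Semigroup.map_nsmul {S : ℝ≥0 → X →L[ℝ] X} (hS : IsC0Semigroup S) (n : ℕ) (t : ℝ≥0) :
    S (n • t) = S t ^ n := by
  induction n with
  | zero => simp [hS.map_zero]
  | succ n ih => rw [succ_nsmul, hS.map_add, ih, pow_succ]

theorem IsC0Semigroup.commute {S : ℝ≥0 → X →L[ℝ] X} (hS : IsC0Semigroup S) (s t : ℝ≥0) :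
    Commute (S s) (S t) := by
  rw [Commute, SemiconjBy, ← hS.map_add, add_comm, hS.map_add]

/-- Two commuting contraction semigroups differ at time `t` by at most `t` times the distance
of their generators. -/
theorem norm_semigroup_sub_le {U V : ℝ≥0 → X →L[ℝ] X} (hU : IsC0Semigroup U)
    (hV : IsC0Semigroup V) (hUc : ∀ t u, ‖U t u‖ ≤ ‖u‖) (hVc : ∀ t u, ‖V t u‖ ≤ ‖u‖)
    (hUV : ∀ t, Commute (U t) (V t)) {u a b : X} (ha : (u, a) ∈ (generator U).graph)
    (hb : (u, b) ∈ (generator V).graph) (t : ℝ≥0) : ‖U t u - V t u‖ ≤ t * ‖a - b‖ := by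
  rcases eq_or_ne t 0 with rfl | ht
  · simp [hU.map_zero, hV.map_zero]
  have htp : 0 < t := pos_iff_ne_zero.2 ht
  -- Cut `[0, t]` into `n` steps of length `t / n`. The power estimate bounds the error by `n` times
  -- that of a single step, which tends to `t * ‖a - b‖`.
  have hlim : Tendsto (fun n : ℕ => t / (n : ℝ≥0)) atTop (𝓝[>] 0) := by
    refine tendsto_nhdsWithin_iff.2 ⟨?_, ?_⟩
    · rw [← NNReal.tendsto_coe]
      simpa using tendsto_const_div_atTop_nhds_zero_nat (t : ℝ)
    · filter_upwards [eventually_gt_atTop 0] with n hn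
      exact div_pos htp (by exact_mod_cast hn)
  have key := (((mem_graph_generator.1 ha).sub (mem_graph_generator.1 hb)).norm.const_mul
    (t : ℝ)).comp hlim
  refine ge_of_tendsto key ?_
  filter_upwards [eventually_gt_atTop 0] with n hn
  have hn0 : (n : ℝ≥0) ≠ 0 := by exact_mod_cast hn.ne'
  have ht' : t = n • (t / n) := by rw [nsmul_eq_mul, mul_div_cancel₀ _ hn0]
  have h1 := norm_pow_sub_pow_apply_le (hUc (t / n)) (hVc (t / n)) (hUV _) n u
  rw [← hU.map_nsmul, ← hV.map_nsmul, ← ht'] at h1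
  refine h1.trans (le_of_eq ?_)
  have ht0 : (t : ℝ) ≠ 0 := by exact_mod_cast ht
  have hn1 : (n : ℝ) ≠ 0 := by exact_mod_cast hn.ne'
  simp only [Function.comp]
  rw [← smul_sub, sub_sub_sub_cancel_right, norm_smul, norm_inv, Real.norm_of_nonneg (by positivity)]
  push_cast
  field_simp

/-- A contractive one-parameter semigroup is strongly continuous as soon as it is so at zero. -/
theorem isC0Semigroup_of_tendsto_zero {S : ℝ≥0 → X →L[ℝ] X} (h0 : S 0 = 1)
    (hadd : ∀ s t, S (s + t) = S s * S t) (hc : ∀ t u, ‖S t u‖ ≤ ‖u‖)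
    (hlim : ∀ u, Tendsto (fun t => S t u) (𝓝 0) (𝓝 u)) : IsC0Semigroup S where
  map_zero := h0
  map_add := hadd
  continuous_orbit u := by
    have key : ∀ s d, ‖S (s + d) u - S s u‖ ≤ ‖S d u - u‖ := fun s d => by
      rw [hadd, mul_apply_eq_comp, ← map_sub]
      exact hc _ _
    -- One of the two truncated differences is zero, so their sum is the distance of `s` and `t`.
    have key' : ∀ s t, ‖S t u - S s u‖ ≤ ‖S (t - s + (s - t)) u - u‖ := fun s t => by
      rcases le_total s t with h | h
      · have := key s (t - s)
        rwa [add_tsub_cancel_of_le h, ← add_zero (t - s), ← tsub_eq_zero_of_le h] at this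
      · have := key t (s - t)
        rw [norm_sub_rev, tsub_eq_zero_of_le h, zero_add]
        rwa [add_tsub_cancel_of_le h] at this
    refine continuous_iff_continuousAt.2 fun s => ?_
    rw [ContinuousAt, tendsto_iff_norm_sub_tendsto_zero]
    refine squeeze_zero (fun t => norm_nonneg _) (key' s) ?_
    have hd : Tendsto (fun t : ℝ≥0 => t - s + (s - t)) (𝓝 s) (𝓝 0) := by
      have : Continuous fun t : ℝ≥0 => t - s + (s - t) := by fun_prop
      exact this.tendsto' s 0 (by simp)
    exact tendsto_iff_norm_sub_tendsto_zero.1 ((hlim u).comp hd)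

/-- Contractions that converge strongly on a dense set converge strongly everywhere. -/
theorem tendsto_apply_of_dense {ι : Type*} {l : Filter ι} {F : ι → X →L[ℝ] X} {G : X →L[ℝ] X}
    (hF : ∀ᶠ i in l, ∀ u, ‖F i u‖ ≤ ‖u‖) (hG : ∀ u, ‖G u‖ ≤ ‖u‖) {D : Set X} (hD : Dense D)
    (h : ∀ u ∈ D, Tendsto (fun i => F i u) l (𝓝 (G u))) (u : X) :
    Tendsto (fun i => F i u) l (𝓝 (G u)) := by
  rw [Metric.tendsto_nhds]
  intro ε hε
  obtain ⟨x, hx, hxu⟩ := Metric.mem_closure_iff.1 (hD u) (ε / 3) (by positivity)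
  filter_upwards [hF, Metric.tendsto_nhds.1 (h x hx) (ε / 3) (by positivity)] with i hi hix
  have e : F i u - G u = F i (u - x) + (F i x - G x) - G (u - x) := by
    rw [map_sub, map_sub]; abel
  rw [dist_eq_norm] at *
  rw [e]
  refine (norm_sub_le _ _).trans_lt ?_
  linarith [norm_add_le (F i (u - x)) (F i x - G x), hi (u - x), hG (u - x)]

end Contractions

/-! ### The resolvent as a Laplace transform -/

section Laplace

variable {X : Type*} [NormedAddCommGroup X] [NormedSpace ℝ X]
  {S : ℝ≥0 → X →L[ℝ] X} {lam : ℝ}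

/-- The integrand of the Laplace transform of an orbit. -/
noncomputable def laplaceIntegrand (S : ℝ≥0 → X →L[ℝ] X) (lam : ℝ) (u : X) (t : ℝ) : X :=
  Real.exp (-lam * t) • S t.toNNReal u

theorem continuous_laplaceIntegrand (hS : IsC0Semigroup S) (lam : ℝ) (u : X) :
    Continuous (laplaceIntegrand S lam u) := by
  have := (hS.continuous_orbit u).comp continuous_real_toNNReal
  unfold laplaceIntegrand
  exact (by fun_prop : Continuous fun t : ℝ => Real.exp (-lam * t)).smul this

theorem norm_laplaceIntegrand_le (hc : ∀ t u, ‖S t u‖ ≤ ‖u‖) (lam : ℝ) (u : X) (t : ℝ) :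
    ‖laplaceIntegrand S lam u t‖ ≤ Real.exp (-lam * t) * ‖u‖ := by
  rw [laplaceIntegrand, norm_smul, Real.norm_of_nonneg (Real.exp_pos _).le]
  exact mul_le_mul_of_nonneg_left (hc _ _) (Real.exp_pos _).le

theorem integrableOn_laplaceIntegrand (hS : IsC0Semigroup S) (hc : ∀ t u, ‖S t u‖ ≤ ‖u‖)
    (hlam : 0 < lam) (u : X) : IntegrableOn (laplaceIntegrand S lam u) (Set.Ioi 0) := by
  refine Integrable.mono' ((exp_neg_integrableOn_Ioi 0 hlam).mul_const ‖u‖)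
    (continuous_laplaceIntegrand hS lam u).aestronglyMeasurable ?_
  exact Eventually.of_forall fun t => norm_laplaceIntegrand_le hc lam u t

/-- The Laplace transform of a contraction semigroup. -/
noncomputable def laplace (S : ℝ≥0 → X →L[ℝ] X) (hS : IsC0Semigroup S) (hc : ∀ t u, ‖S t u‖ ≤ ‖u‖)
    (lam : ℝ) (hlam : 0 < lam) : X →L[ℝ] X :=
  LinearMap.mkContinuous
    { toFun := fun u => ∫ t in Set.Ioi (0 : ℝ), laplaceIntegrand S lam u t
      map_add' := fun u v => by
        rw [← integral_add (integrableOn_laplaceIntegrand hS hc hlam u)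
          (integrableOn_laplaceIntegrand hS hc hlam v)]
        simp [laplaceIntegrand]
      map_smul' := fun c u => by
        rw [RingHom.id_apply, ← integral_smul]
        simp [laplaceIntegrand, smul_comm c] } lam⁻¹ (fun u => by
    have h1 : ∫ t in Set.Ioi (0 : ℝ), Real.exp (-lam * t) = lam⁻¹ := by
      rw [integral_exp_mul_Ioi (by linarith)]; simp
    rw [← h1, ← integral_mul_const]
    exact norm_integral_le_of_norm_le ((exp_neg_integrableOn_Ioi 0 hlam).mul_const ‖u‖)
      (Eventually.of_forall fun t => norm_laplaceIntegrand_le hc lam u t))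

variable (hS : IsC0Semigroup S) (hc : ∀ t u, ‖S t u‖ ≤ ‖u‖) (hlam : 0 < lam)

theorem laplace_apply (u : X) :
    laplace S hS hc lam hlam u = ∫ t in Set.Ioi (0 : ℝ), laplaceIntegrand S lam u t := rfl

theorem norm_laplace_le (u : X) : ‖laplace S hS hc lam hlam u‖ ≤ lam⁻¹ * ‖u‖ :=
  ContinuousLinearMap.le_of_opNorm_le _ (LinearMap.mkContinuous_norm_le _ (by positivity) _) u

theorem laplace_apply_nonneg [PartialOrder X] [IsOrderedAddMonoid X] [IsOrderedModule ℝ X]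
    [ClosedIciTopology X] (hp : ∀ t u, 0 ≤ u → 0 ≤ S t u) {u : X} (hu : 0 ≤ u) :
    0 ≤ laplace S hS hc lam hlam u := by
  rw [laplace_apply]
  exact integral_nonneg fun t => smul_nonneg (Real.exp_pos _).le (hp _ _ hu)

variable [CompleteSpace X]

theorem semigroup_laplace (h : ℝ≥0) (u : X) :
    S h (laplace S hS hc lam hlam u) = laplace S hS hc lam hlam (S h u) := by
  rw [laplace_apply, laplace_apply, ← ContinuousLinearMap.integral_comp_comm _
    (integrableOn_laplaceIntegrand hS hc hlam u)]
  refine integral_congr_ae (Eventually.of_forall fun t => ?_)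
  simp only [laplaceIntegrand, map_smul]
  rw [← mul_apply_eq_comp, (hS.commute _ _).eq, mul_apply_eq_comp]

/-- Translating the variable turns `S h` into a factor `exp (lam * h)` and the integral over `(h,
∞)`. In this form the orbit is visibly differentiable in `h`, for every `u`. -/
theorem semigroup_laplace_eq (h : ℝ≥0) (u : X) :
    S h (laplace S hS hc lam hlam u) = Real.exp (lam * h) • (laplace S hS hc lam hlam u
      - ∫ t in (0 : ℝ)..h, laplaceIntegrand S lam u t) := by
  have hint := integrableOn_laplaceIntegrand hS hc hlam u
  have hint' : IntegrableOn (laplaceIntegrand S lam u) (Set.Ioi (h : ℝ)) :=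
    hint.mono_set (Set.Ioi_subset_Ioi h.2)
  have h1 : laplace S hS hc lam hlam u - ∫ t in (0 : ℝ)..h, laplaceIntegrand S lam u t
      = ∫ t in Set.Ioi (h : ℝ), laplaceIntegrand S lam u t := by
    rw [laplace_apply, ← intervalIntegral.integral_interval_add_Ioi hint hint', add_sub_cancel_left]
  have h2 := (measurePreserving_add_right volume (h : ℝ)).setIntegral_preimage_emb
    (measurableEmbedding_addRight (h : ℝ)) (laplaceIntegrand S lam u) (Set.Ioi (h : ℝ))
  have h3 : (fun x : ℝ => x + h) ⁻¹' Set.Ioi (h : ℝ) = Set.Ioi 0 := by ext x; simp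
  rw [h1, ← h2, h3, laplace_apply, ← ContinuousLinearMap.integral_comp_comm _ hint,
    ← integral_smul]
  refine setIntegral_congr_fun measurableSet_Ioi fun t ht => ?_
  have ht' : (0 : ℝ) ≤ t := le_of_lt ht
  simp only [laplaceIntegrand, map_smul, smul_smul]
  rw [Real.toNNReal_add ht' h.coe_nonneg, Real.toNNReal_coe, add_comm t.toNNReal, hS.map_add,
    mul_apply_eq_comp, ← Real.exp_add]
  congr 2
  ring

theorem laplace_mem_graph (u : X) :
    (laplace S hS hc lam hlam u, lam • laplace S hS hc lam hlam u - u) ∈ (generator S).graph := by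
  set F := laplaceIntegrand S lam u
  have hF : Continuous F := continuous_laplaceIntegrand hS lam u
  have hF0 : F 0 = u := by simp [F, laplaceIntegrand, hS.map_zero]
  have hd : HasDerivAt (fun h : ℝ => ∫ t in (0 : ℝ)..h, F t) (F 0) 0 :=
    (hF.integral_hasStrictDerivAt 0 0).hasDerivAt
  have he : HasDerivAt (fun h : ℝ => Real.exp (lam * h)) lam 0 := by
    simpa using ((hasDerivAt_id (0 : ℝ)).const_mul lam).exp
  have hG := he.smul (hd.const_sub (laplace S hS hc lam hlam u))
  refine mem_graph_generator_of_hasDerivAt (G := fun h : ℝ => Real.exp (lam * h) •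
    (laplace S hS hc lam hlam u - ∫ t in (0 : ℝ)..h, F t)) ?_ ?_ fun h => ?_
  · rw [intervalIntegral.integral_same, hF0, mul_zero, Real.exp_zero, one_smul, sub_zero] at hG
    exact hG.congr_deriv (by abel)
  · simp
  · exact semigroup_laplace_eq hS hc hlam h u

/-- The transform commutes with the difference quotients of `S`, hence with the generator on its
domain. -/
theorem laplace_of_mem_graph {u v : X} (h : (u, v) ∈ (generator S).graph) :
    laplace S hS hc lam hlam (lam • u - v) = u := by
  have h1 := ((laplace S hS hc lam hlam).continuous.tendsto v).comp (mem_graph_generator.1 h)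
  have h2 := mem_graph_generator.1 (laplace_mem_graph hS hc hlam u)
  have h3 : laplace S hS hc lam hlam v = lam • laplace S hS hc lam hlam u - u := by
    refine tendsto_nhds_unique (h1.congr fun t => ?_) h2
    simp [semigroup_laplace]
  rw [map_sub, h3, map_smul, sub_sub_cancel]

theorem mem_resolventSet (hS : IsC0Semigroup S) (hc : ∀ t u, ‖S t u‖ ≤ ‖u‖) (hlam : 0 < lam) :
    lam ∈ resolventSet (generator S) := by
  have h : ∀ u, laplace S hS hc lam hlam (shift (generator S) lam u) = u := fun u =>
    laplace_of_mem_graph hS hc hlam ((generator S).mem_graph u)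
  refine ⟨⟨fun u v huv => Subtype.ext ?_, fun v => ?_⟩, _, h⟩
  · rw [← h u, ← h v, huv]
  · obtain ⟨y, hy, hy'⟩ := (LinearPMap.mem_graph_iff _).1 (laplace_mem_graph hS hc hlam v)
    refine ⟨y, ?_⟩
    change lam • (y : X) - generator S y = v
    rw [hy', hy, sub_sub_cancel]

/-- Substituting `s = lam * t` gives the integral of `exp (-s) • S (s / lam) u`, to which dominated
convergence applies. -/
theorem tendsto_smul_laplace (u : X) :
    Tendsto (fun lam : ℝ => if h : 0 < lam then lam • laplace S hS hc lam h u else 0) atTop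
      (𝓝 u) := by
  have h1 : Tendsto (fun lam : ℝ => ∫ s in Set.Ioi (0 : ℝ),
      Real.exp (-s) • S (lam⁻¹ * s).toNNReal u) atTop
      (𝓝 (∫ s in Set.Ioi (0 : ℝ), Real.exp (-s) • u)) := by
    refine tendsto_integral_filter_of_dominated_convergence (fun s => Real.exp (-s) * ‖u‖)
      (Eventually.of_forall fun lam => ?_) (Eventually.of_forall fun lam =>
        Eventually.of_forall fun s => ?_) ((integrableOn_exp_neg_Ioi 0).mul_const _)
      (Eventually.of_forall fun s => ?_)
    · have : Continuous fun s : ℝ => S (lam⁻¹ * s).toNNReal u :=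
        (hS.continuous_orbit u).comp (continuous_real_toNNReal.comp (by fun_prop))
      exact ((by fun_prop : Continuous fun s : ℝ => Real.exp (-s)).smul this).aestronglyMeasurable
    · rw [norm_smul, Real.norm_of_nonneg (Real.exp_pos _).le]
      exact mul_le_mul_of_nonneg_left (hc _ _) (Real.exp_pos _).le
    · have h0 : Tendsto (fun lam : ℝ => (lam⁻¹ * s).toNNReal) atTop (𝓝 0) := by
        have := (tendsto_inv_atTop_zero (𝕜 := ℝ)).mul_const s
        rw [zero_mul] at this
        exact (continuous_real_toNNReal.tendsto' 0 0 Real.toNNReal_zero).comp this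
      have := ((hS.continuous_orbit u).tendsto 0).comp h0
      rw [hS.map_zero] at this
      exact this.const_smul _
  rw [integral_smul_const, integral_exp_neg_Ioi_zero, one_smul] at h1
  refine h1.congr' ?_
  filter_upwards [eventually_gt_atTop 0] with lam hlam
  rw [dif_pos hlam, laplace_apply]
  have := integral_comp_mul_left_Ioi' (fun s => Real.exp (-s) • S (lam⁻¹ * s).toNNReal u) 0 hlam
  rw [mul_zero] at this
  rw [← this]
  congr 1
  refine integral_congr_ae (Eventually.of_forall fun t => ?_)
  simp only [laplaceIntegrand]
  rw [inv_mul_cancel_left₀ hlam.ne', neg_mul]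

end Laplace

/-! ### Exponentials of bounded operators -/

section Exponential

variable {X : Type*} [NormedAddCommGroup X] [NormedSpace ℝ X] [CompleteSpace X]

theorem hasSum_exp_apply (C : X →L[ℝ] X) (s : ℝ) (u : X) :
    HasSum (fun n : ℕ => (s ^ n / n.factorial) • (C ^ n) u) (NormedSpace.exp (s • C) u) := by
  have h := NormedSpace.exp_series_hasSum_exp' (𝕂 := ℝ) (s • C)
  refine (h.mapL (ContinuousLinearMap.apply ℝ X u)).congr_fun fun n => ?_
  simp [smul_pow, smul_smul, div_eq_inv_mul]

theorem hasSum_real_exp (s : ℝ) : HasSum (fun n : ℕ => s ^ n / n.factorial) (Real.exp s) := by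
  rw [Real.exp_eq_exp_ℝ]
  exact NormedSpace.expSeries_div_hasSum_exp s

/-- Splitting off the scalar part leaves a power series in `C` with nonnegative coefficients when `s
≥ 0`; contractivity and positivity are read off from it. -/
theorem exp_smul_sub_one (C : X →L[ℝ] X) (s : ℝ) :
    NormedSpace.exp (s • (C - 1)) = Real.exp (-s) • NormedSpace.exp (s • C) := by
  let _ : NormedAlgebra ℚ (X →L[ℝ] X) := NormedAlgebra.restrictScalars ℚ ℝ _
  have e : s • (C - 1) = algebraMap ℝ (X →L[ℝ] X) (-s) + s • C := by
    rw [Algebra.algebraMap_eq_smul_one, smul_sub, neg_smul]; abel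
  rw [e, NormedSpace.exp_add_of_commute (Algebra.commutes _ _), ← NormedSpace.algebraMap_exp_comm,
    ← Real.exp_eq_exp_ℝ, Algebra.algebraMap_eq_smul_one, smul_mul_assoc, one_mul]

theorem norm_exp_smul_sub_one_le {C : X →L[ℝ] X} (hC : ∀ u, ‖C u‖ ≤ ‖u‖) {s : ℝ} (hs : 0 ≤ s)
    (u : X) : ‖NormedSpace.exp (s • (C - 1)) u‖ ≤ ‖u‖ := by
  rw [exp_smul_sub_one, smul_apply, norm_smul,
    Real.norm_of_nonneg (Real.exp_pos _).le]
  have h1 : ‖NormedSpace.exp (s • C) u‖ ≤ Real.exp s * ‖u‖ := by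
    refine (hasSum_exp_apply C s u).norm_le_of_bounded ((hasSum_real_exp s).mul_right ‖u‖)
      fun n => ?_
    rw [norm_smul, Real.norm_of_nonneg (by positivity)]
    exact mul_le_mul_of_nonneg_left (norm_pow_apply_le hC n u) (by positivity)
  calc Real.exp (-s) * ‖NormedSpace.exp (s • C) u‖ ≤ Real.exp (-s) * (Real.exp s * ‖u‖) :=
        mul_le_mul_of_nonneg_left h1 (Real.exp_pos _).le
    _ = ‖u‖ := by rw [← mul_assoc, ← Real.exp_add, neg_add_cancel, Real.exp_zero, one_mul]

/-- The uniformly continuous semigroup with bounded generator `A`. -/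
noncomputable def expSemigroup (A : X →L[ℝ] X) (t : ℝ≥0) : X →L[ℝ] X := NormedSpace.exp ((t : ℝ) • A)

theorem isC0Semigroup_expSemigroup (A : X →L[ℝ] X) : IsC0Semigroup (expSemigroup A) := by
  let _ : NormedAlgebra ℚ (X →L[ℝ] X) := NormedAlgebra.restrictScalars ℚ ℝ _
  refine ⟨by simp [expSemigroup], fun s t => ?_, fun u => ?_⟩
  · rw [expSemigroup, NNReal.coe_add, add_smul, NormedSpace.exp_add_of_commute]
    · rfl
    · exact ((Commute.refl A).smul_left _).smul_right _
  · have : Continuous fun t : ℝ≥0 => expSemigroup A t :=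
      NormedSpace.exp_continuous.comp (by fun_prop)
    fun_prop

theorem mem_graph_expSemigroup (A : X →L[ℝ] X) (u : X) :
    (u, A u) ∈ (generator (expSemigroup A)).graph := by
  refine mem_graph_generator_of_hasDerivAt (G := fun t : ℝ => NormedSpace.exp (t • A) u) ?_ ?_
    fun t => rfl
  · have h := (ContinuousLinearMap.apply ℝ X u).hasFDerivAt.comp_hasDerivAt (0 : ℝ)
      (hasDerivAt_exp_smul_const (𝕂 := ℝ) A (0 : ℝ))
    simp only [zero_smul, NormedSpace.exp_zero, one_mul] at h
    exact h
  · simp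

omit [CompleteSpace X] in
theorem commute_expSemigroup {A C : X →L[ℝ] X} (h : Commute C A) (t : ℝ≥0) :
    Commute C (expSemigroup A t) :=
  Commute.exp_right (h.smul_right _)

end Exponential

/-! ### Yosida approximation and the Hille–Yosida theorem -/

section Yosida

variable {X : Type*} [NormedAddCommGroup X] [NormedSpace ℝ X]

/-- The properties of the resolvent family of the generator of a contraction semigroup. -/
structure IsContractionResolvent (R : ℝ → X →L[ℝ] X) : Prop where
  norm_le : ∀ lam, 0 < lam → ∀ u, ‖R lam u‖ ≤ lam⁻¹ * ‖u‖
  sub_eq : ∀ lam mu, 0 < lam → 0 < mu → R lam - R mu = (mu - lam) • (R lam * R mu)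
  tendsto : ∀ u, Tendsto (fun lam : ℝ => lam • R lam u) atTop (𝓝 u)

/-- The Yosida approximation of the operator with resolvent `R`. -/
noncomputable def yosida (R : ℝ → X →L[ℝ] X) (lam : ℝ) : X →L[ℝ] X := lam • (lam • R lam - 1)

theorem commute_yosida {R : ℝ → X →L[ℝ] X} {C : X →L[ℝ] X} {lam : ℝ} (h : Commute C (R lam)) :
    Commute C (yosida R lam) :=
  ((h.smul_right _).sub_right (Commute.one_right _)).smul_right _

variable {R : ℝ → X →L[ℝ] X} (hR : IsContractionResolvent R)

namespace IsContractionResolvent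
include hR

theorem commute {lam mu : ℝ} (hlam : 0 < lam) (hmu : 0 < mu) : Commute (R lam) (R mu) := by
  rcases eq_or_ne lam mu with rfl | hne
  · exact Commute.refl _
  have h1 := hR.sub_eq lam mu hlam hmu
  have h2 := hR.sub_eq mu lam hmu hlam
  rw [← neg_sub, h2, ← neg_smul, neg_sub] at h1
  exact (smul_right_injective _ (sub_ne_zero.2 hne.symm) h1).symm

theorem norm_smul_le {lam : ℝ} (hlam : 0 < lam) (u : X) : ‖(lam • R lam) u‖ ≤ ‖u‖ := by
  rw [smul_apply, norm_smul, Real.norm_of_nonneg hlam.le]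
  calc lam * ‖R lam u‖ ≤ lam * (lam⁻¹ * ‖u‖) :=
        mul_le_mul_of_nonneg_left (hR.norm_le lam hlam u) hlam.le
    _ = ‖u‖ := mul_inv_cancel_left₀ hlam.ne' _

/-- By the resolvent identity all `R lam` have the same range, and `lam • R lam u` tends to `u`. -/
theorem dense_range {nu : ℝ} (hnu : 0 < nu) : Dense (Set.range (R nu)) := by
  intro u
  refine mem_closure_of_tendsto (hR.tendsto u) ?_
  filter_upwards [eventually_gt_atTop 0] with lam hlam
  refine ⟨lam • (u + (nu - lam) • R lam u), ?_⟩
  have h := congrArg (fun F : X →L[ℝ] X => F u) (hR.sub_eq lam nu hlam hnu)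
  simp only [(hR.commute hlam hnu).eq, sub_apply,
    smul_apply, mul_apply_eq_comp] at h
  rw [map_smul, map_add, map_smul, ← h, add_sub_cancel]

/-- The vector `nu • R nu v - v` is the value at `R nu v` of the operator with resolvent `R`. The
approximation is this value smoothed by `lam • R lam`, and so converges to it. -/
theorem yosida_apply_eq {lam nu : ℝ} (hlam : 0 < lam) (hnu : 0 < nu) (v : X) :
    yosida R lam (R nu v) = lam • R lam (nu • R nu v - v) := by
  have h := congrArg (fun F : X →L[ℝ] X => F v) (hR.sub_eq lam nu hlam hnu)
  simp only [sub_apply, smul_apply,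
    mul_apply_eq_comp, sub_smul] at h
  have h' : R nu v = R lam v - (nu • R lam (R nu v) - lam • R lam (R nu v)) := by
    rw [← h, sub_sub_cancel]
  simp only [yosida, smul_apply, sub_apply,
    one_apply_eq_self, map_sub, map_smul]
  congr 1
  nth_rw 2 [h']
  abel

theorem tendsto_yosida {nu : ℝ} (hnu : 0 < nu) (v : X) :
    Tendsto (fun lam => yosida R lam (R nu v)) atTop (𝓝 (nu • R nu v - v)) := by
  refine (hR.tendsto _).congr' ?_
  filter_upwards [eventually_gt_atTop 0] with lam hlam
  exact (hR.yosida_apply_eq hlam hnu v).symm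

variable [CompleteSpace X]

theorem norm_expSemigroup_le {lam : ℝ} (hlam : 0 < lam) (t : ℝ≥0) (u : X) :
    ‖expSemigroup (yosida R lam) t u‖ ≤ ‖u‖ := by
  rw [expSemigroup, yosida, smul_smul]
  exact norm_exp_smul_sub_one_le (hR.norm_smul_le hlam) (by positivity) u

theorem norm_expSemigroup_sub_le {lam mu : ℝ} (hlam : 0 < lam) (hmu : 0 < mu) (t : ℝ≥0) (u : X) :
    ‖expSemigroup (yosida R lam) t u - expSemigroup (yosida R mu) t u‖
      ≤ t * ‖yosida R lam u - yosida R mu u‖ :=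
  norm_semigroup_sub_le (isC0Semigroup_expSemigroup _) (isC0Semigroup_expSemigroup _)
    (hR.norm_expSemigroup_le hlam) (hR.norm_expSemigroup_le hmu)
    (fun t => commute_expSemigroup (commute_expSemigroup (commute_yosida
      (commute_yosida (hR.commute hmu hlam)).symm) t).symm t |>.symm)
    (mem_graph_expSemigroup _ u) (mem_graph_expSemigroup _ u) t

theorem cauchy_expSemigroup (t : ℝ≥0) (u : X) :
    Cauchy (map (fun lam => expSemigroup (yosida R lam) t u) atTop) := by
  rw [Metric.cauchy_iff]
  refine ⟨inferInstance, fun ε hε => ?_⟩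
  obtain ⟨_, ⟨v, rfl⟩, hv⟩ := Metric.mem_closure_iff.1 (hR.dense_range one_pos u) (ε / 4)
    (by positivity)
  have h := hR.tendsto_yosida one_pos v
  -- The summand `1` keeps the denominator positive when `t = 0`.
  obtain ⟨s, hs, hsε⟩ := (Metric.cauchy_iff.1 h.cauchy_map).2 (ε / (4 * (t + 1))) (by positivity)
  refine ⟨_, image_mem_map (inter_mem (mem_map.1 hs) (eventually_gt_atTop 0)), ?_⟩
  rintro _ ⟨lam, ⟨hlam, hlam0⟩, rfl⟩ _ ⟨mu, ⟨hmu, hmu0⟩, rfl⟩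
  have h1 := hsε _ hlam _ hmu
  have h2 := hR.norm_expSemigroup_sub_le hlam0 hmu0 t (R 1 v)
  have h3 := hR.norm_expSemigroup_le hlam0 t (u - R 1 v)
  have h4 := hR.norm_expSemigroup_le hmu0 t (u - R 1 v)
  rw [dist_eq_norm] at *
  have e : expSemigroup (yosida R lam) t u - expSemigroup (yosida R mu) t u
      = expSemigroup (yosida R lam) t (u - R 1 v) + (expSemigroup (yosida R lam) t (R 1 v)
        - expSemigroup (yosida R mu) t (R 1 v)) - expSemigroup (yosida R mu) t (u - R 1 v) := by
    rw [map_sub, map_sub]; abel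
  have h5 : (t : ℝ) * ‖yosida R lam (R 1 v) - yosida R mu (R 1 v)‖ ≤ ε / 4 := by
    calc (t : ℝ) * ‖yosida R lam (R 1 v) - yosida R mu (R 1 v)‖
        ≤ (t + 1) * (ε / (4 * (t + 1))) := by
          gcongr
          · linarith
      _ = ε / 4 := by field_simp
  rw [e]
  refine (norm_sub_le _ _).trans_lt ?_
  linarith [norm_add_le (expSemigroup (yosida R lam) t (u - R 1 v))
    (expSemigroup (yosida R lam) t (R 1 v) - expSemigroup (yosida R mu) t (R 1 v))]

/-- The **Hille–Yosida theorem** for contraction semigroups. -/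
theorem exists_semigroup : ∃ P : ℝ≥0 → X →L[ℝ] X, IsC0Semigroup P ∧ (∀ t u, ‖P t u‖ ≤ ‖u‖) ∧
    (∀ t u, Tendsto (fun lam => expSemigroup (yosida R lam) t u) atTop (𝓝 (P t u))) ∧
    ∀ nu, 0 < nu → ∀ v, (R nu v, nu • R nu v - v) ∈ (generator P).graph := by
  choose p hp using fun t u => cauchy_map_iff_exists_tendsto.1 (hR.cauchy_expSemigroup t u)
  have hpn : ∀ t u, ‖p t u‖ ≤ ‖u‖ := fun t u => by
    refine le_of_tendsto (hp t u).norm ?_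
    filter_upwards [eventually_gt_atTop 0] with lam hlam
    exact hR.norm_expSemigroup_le hlam t u
  let P : ℝ≥0 → X →L[ℝ] X := fun t => LinearMap.mkContinuous
    { toFun := p t
      map_add' := fun u v => tendsto_nhds_unique (hp t (u + v))
        (((hp t u).add (hp t v)).congr fun lam => (map_add _ _ _).symm)
      map_smul' := fun c u => tendsto_nhds_unique (hp t (c • u))
        (((hp t u).const_smul c).congr fun lam => (map_smul _ _ _).symm) } 1
    fun u => by rw [one_mul]; exact hpn t u
  have hP : ∀ t u, Tendsto (fun lam => expSemigroup (yosida R lam) t u) atTop (𝓝 (P t u)) := hp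
  have hPn : ∀ t u, ‖P t u‖ ≤ ‖u‖ := hpn
  have hP0 : P 0 = 1 := by
    ext u
    refine tendsto_nhds_unique (hP 0 u) (tendsto_const_nhds.congr fun lam => ?_)
    rw [(isC0Semigroup_expSemigroup _).map_zero]
  have hPadd : ∀ s t, P (s + t) = P s * P t := fun s t => by
    ext u
    rw [mul_apply_eq_comp]
    refine tendsto_nhds_unique (hP (s + t) u) ?_
    have h1 : Tendsto (fun lam => expSemigroup (yosida R lam) s
        (expSemigroup (yosida R lam) t u - P t u)) atTop (𝓝 0) := by
      refine squeeze_zero_norm' ?_ (tendsto_iff_norm_sub_tendsto_zero.1 (hP t u))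
      filter_upwards [eventually_gt_atTop 0] with lam hlam
      exact hR.norm_expSemigroup_le hlam s _
    have h2 := h1.add (hP s (P t u))
    rw [zero_add] at h2
    refine h2.congr fun lam => ?_
    rw [(isC0Semigroup_expSemigroup _).map_add, mul_apply_eq_comp, map_sub, sub_add_cancel]
  -- The comparison of two approximating semigroups, with the second parameter sent to infinity. The
  -- error is linear in `t`, so it survives division by `t` in the difference quotient.
  have hgen : ∀ nu, 0 < nu → ∀ v t lam, 0 < lam → ‖P t (R nu v) -
      expSemigroup (yosida R lam) t (R nu v)‖ ≤ t * ‖nu • R nu v - v - yosida R lam (R nu v)‖ := by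
    intro nu hnu v t lam hlam
    refine le_of_tendsto_of_tendsto ((hP t (R nu v)).sub tendsto_const_nhds).norm
      (((hR.tendsto_yosida hnu v).sub tendsto_const_nhds).norm.const_mul (t : ℝ)) ?_
    filter_upwards [eventually_gt_atTop 0] with mu hmu
    exact hR.norm_expSemigroup_sub_le hmu hlam t _
  have hderiv : ∀ nu, 0 < nu → ∀ v, (R nu v, nu • R nu v - v) ∈ (generator P).graph := by
    intro nu hnu v
    rw [mem_graph_generator, Metric.tendsto_nhds]
    intro ε hε
    obtain ⟨lam, hlam, hlam0⟩ := ((Metric.tendsto_nhds.1 (hR.tendsto_yosida hnu v) (ε / 3)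
      (by positivity)).and (eventually_gt_atTop 0)).exists
    have h1 := Metric.tendsto_nhds.1 (mem_graph_generator.1 (mem_graph_expSemigroup
      (yosida R lam) (R nu v))) (ε / 3) (by positivity)
    filter_upwards [h1, self_mem_nhdsWithin] with t ht ht0
    have ht0' : (0 : ℝ) < t := ht0
    have h2 := hgen nu hnu v t lam hlam0
    set x := R nu v
    rw [dist_eq_norm] at *
    have e : (t : ℝ)⁻¹ • (P t x - x) - (nu • x - v)
        = (t : ℝ)⁻¹ • (P t x - expSemigroup (yosida R lam) t x)
          + ((t : ℝ)⁻¹ • (expSemigroup (yosida R lam) t x - x) - yosida R lam x)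
          + (yosida R lam x - (nu • x - v)) := by
      simp only [smul_sub]; abel
    have h3 : ‖(t : ℝ)⁻¹ • (P t x - expSemigroup (yosida R lam) t x)‖ < ε / 3 := by
      rw [norm_smul, norm_inv, Real.norm_of_nonneg ht0'.le]
      refine lt_of_le_of_lt ?_ hlam
      rw [inv_mul_le_iff₀ ht0', norm_sub_rev (yosida R lam x)]
      exact h2
    rw [e]
    refine (norm_add₃_le).trans_lt ?_
    linarith
  refine ⟨P, isC0Semigroup_of_tendsto_zero hP0 hPadd hPn fun u => ?_, hPn, hP, hderiv⟩
  refine tendsto_apply_of_dense (G := 1) (Eventually.of_forall hPn) (fun u => le_rfl)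
    (hR.dense_range one_pos) ?_ u
  rintro _ ⟨v, rfl⟩
  rw [one_apply_eq_self, tendsto_iff_norm_sub_tendsto_zero]
  have hb : ∀ t, ‖P t (R 1 v) - R 1 v‖ ≤ t * ‖(1 : ℝ) • R 1 v - v‖ := fun t => by
    refine le_of_tendsto_of_tendsto ((hP t (R 1 v)).sub tendsto_const_nhds).norm
      ((hR.tendsto_yosida one_pos v).norm.const_mul (t : ℝ)) ?_
    filter_upwards [eventually_gt_atTop 0] with mu hmu
    -- The comparison semigroup is the constant one, generated by zero.
    have := norm_semigroup_sub_le (isC0Semigroup_expSemigroup (yosida R mu))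
      (isC0Semigroup_expSemigroup 0) (hR.norm_expSemigroup_le hmu)
      (fun t u => by simp [expSemigroup]) (fun t => by simp [expSemigroup])
      (mem_graph_expSemigroup _ (R 1 v)) (mem_graph_expSemigroup _ (R 1 v)) t
    simpa [expSemigroup] using this
  refine squeeze_zero (fun t => norm_nonneg _) hb ?_
  have : Continuous fun t : ℝ≥0 => (t : ℝ) * ‖(1 : ℝ) • R 1 v - v‖ := by fun_prop
  exact this.tendsto' 0 0 (by simp)

/-- A contraction semigroup whose generator extends the operator with resolvent `R` is the limit
of the exponentials of the Yosida approximations. -/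
theorem tendsto_expSemigroup {S : ℝ≥0 → X →L[ℝ] X} (hS : IsC0Semigroup S)
    (hc : ∀ t u, ‖S t u‖ ≤ ‖u‖) (hcomm : ∀ t lam, 0 < lam → Commute (S t) (R lam))
    (hgen : ∀ v, (R 1 v, R 1 v - v) ∈ (generator S).graph) (t : ℝ≥0) (u : X) :
    Tendsto (fun lam => expSemigroup (yosida R lam) t u) atTop (𝓝 (S t u)) := by
  refine tendsto_apply_of_dense ?_ (hc t) (hR.dense_range one_pos) ?_ u
  · filter_upwards [eventually_gt_atTop 0] with lam hlam
    exact hR.norm_expSemigroup_le hlam t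
  rintro _ ⟨v, rfl⟩
  rw [tendsto_iff_norm_sub_tendsto_zero]
  have h := (tendsto_iff_norm_sub_tendsto_zero.1 (hR.tendsto_yosida one_pos v)).const_mul (t : ℝ)
  rw [mul_zero] at h
  refine squeeze_zero' (Eventually.of_forall fun lam => norm_nonneg _) ?_ h
  filter_upwards [eventually_gt_atTop 0] with lam hlam
  rw [one_smul]
  exact norm_semigroup_sub_le (isC0Semigroup_expSemigroup _) hS (hR.norm_expSemigroup_le hlam) hc
    (fun t => (commute_expSemigroup (commute_yosida (hcomm t lam hlam)) t).symm)
    (mem_graph_expSemigroup _ _) (hgen v) t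

end IsContractionResolvent

theorem isContractionResolvent_laplace [CompleteSpace X] {S : ℝ≥0 → X →L[ℝ] X}
    (hS : IsC0Semigroup S) (hc : ∀ t u, ‖S t u‖ ≤ ‖u‖) :
    IsContractionResolvent fun lam => if h : 0 < lam then laplace S hS hc lam h else 0 where
  norm_le lam hlam u := by
    rw [dif_pos hlam]
    exact norm_laplace_le hS hc hlam u
  sub_eq lam mu hlam hmu := by
    rw [dif_pos hlam, dif_pos hmu]
    ext u
    have h := laplace_of_mem_graph hS hc hlam (laplace_mem_graph hS hc hmu u)
    simp only [sub_apply, smul_apply, mul_apply_eq_comp]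
    rw [map_sub, map_sub, map_smul, map_smul] at h
    nth_rw 1 [← h]
    rw [sub_smul]
    abel
  tendsto u := by
    refine (tendsto_smul_laplace hS hc u).congr fun lam => ?_
    split_ifs with h <;> simp

theorem tendsto_expSemigroup_laplace [CompleteSpace X] {S : ℝ≥0 → X →L[ℝ] X}
    (hS : IsC0Semigroup S) (hc : ∀ t u, ‖S t u‖ ≤ ‖u‖) (t : ℝ≥0) (u : X) :
    Tendsto (fun lam => expSemigroup (yosida (fun lam => if h : 0 < lam then
      laplace S hS hc lam h else 0) lam) t u) atTop (𝓝 (S t u)) := by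
  refine (isContractionResolvent_laplace hS hc).tendsto_expSemigroup hS hc (fun t lam hlam => ?_)
    (fun v => ?_) t u
  · rw [dif_pos hlam]
    ext v
    exact semigroup_laplace hS hc hlam t v
  · rw [dif_pos one_pos]
    simpa using laplace_mem_graph hS hc one_pos v

end Yosida

theorem expSemigroup_yosida_apply {X : Type*} [NormedAddCommGroup X] [NormedSpace ℝ X]
    [CompleteSpace X] (R : ℝ → X →L[ℝ] X) (lam : ℝ) (t : ℝ≥0) (u : X) :
    expSemigroup (yosida R lam) t u
      = Real.exp (-(t * lam)) • NormedSpace.exp ((t * lam * lam) • R lam) u := by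
  rw [expSemigroup, yosida, smul_smul, exp_smul_sub_one, smul_smul, smul_apply]

/-! ### From order between resolvents to order between semigroups -/

section Order

variable {X : Type*} [NormedAddCommGroup X] [NormedSpace ℝ X] [PartialOrder X]
  [IsOrderedAddMonoid X]

omit [NormedSpace ℝ X] in
theorem map_le_map_of_nonneg {F : Type*} [FunLike F X X] [AddMonoidHomClass F X X] {C : F}
    (hC : ∀ u, 0 ≤ u → 0 ≤ C u) {u v : X} (h : u ≤ v) : C u ≤ C v := by
  rw [← sub_nonneg, ← map_sub]
  exact hC _ (sub_nonneg.2 h)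

omit [IsOrderedAddMonoid X] in
theorem pow_apply_nonneg {C : X →L[ℝ] X} (hC : ∀ u, 0 ≤ u → 0 ≤ C u) (n : ℕ) {u : X}
    (hu : 0 ≤ u) : 0 ≤ (C ^ n) u := by
  induction n with
  | zero => simpa using hu
  | succ n ih => rw [pow_succ', mul_apply_eq_comp]; exact hC _ ih

theorem pow_apply_le_pow_apply {C D : X →L[ℝ] X} (hC : ∀ u, 0 ≤ u → 0 ≤ C u)
    (hCD : ∀ u, 0 ≤ u → C u ≤ D u) (n : ℕ) {u : X} (hu : 0 ≤ u) : (C ^ n) u ≤ (D ^ n) u := by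
  induction n with
  | zero => simp
  | succ n ih =>
    rw [pow_succ', pow_succ', mul_apply_eq_comp, mul_apply_eq_comp]
    exact (hCD _ (pow_apply_nonneg hC n hu)).trans
      (map_le_map_of_nonneg (fun v hv => (hC v hv).trans (hCD v hv)) ih)

variable [CompleteSpace X] [IsOrderedModule ℝ X] [OrderClosedTopology X]

theorem expSemigroup_yosida_nonneg {R : ℝ → X →L[ℝ] X} {lam : ℝ} (hlam : 0 < lam)
    (hR : ∀ u, 0 ≤ u → 0 ≤ R lam u) (t : ℝ≥0) {u : X} (hu : 0 ≤ u) :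
    0 ≤ expSemigroup (yosida R lam) t u := by
  rw [expSemigroup_yosida_apply]
  exact smul_nonneg (Real.exp_pos _).le ((hasSum_exp_apply _ _ _).nonneg fun n =>
    smul_nonneg (by positivity) (pow_apply_nonneg hR n hu))

theorem expSemigroup_yosida_le {R R' : ℝ → X →L[ℝ] X} {lam : ℝ} (hlam : 0 < lam)
    (hR : ∀ u, 0 ≤ u → 0 ≤ R lam u) (hRR' : ∀ u, 0 ≤ u → R lam u ≤ R' lam u) (t : ℝ≥0) {u : X}
    (hu : 0 ≤ u) : expSemigroup (yosida R lam) t u ≤ expSemigroup (yosida R' lam) t u := by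
  rw [expSemigroup_yosida_apply, expSemigroup_yosida_apply]
  refine smul_le_smul_of_nonneg_left ?_ (Real.exp_pos _).le
  exact hasSum_le (fun n => smul_le_smul_of_nonneg_left (pow_apply_le_pow_apply hR hRR' n hu)
    (by positivity)) (hasSum_exp_apply _ _ _) (hasSum_exp_apply _ _ _)

end Order

/-! ### The positive cone of `L¹` -/

section L1

variable {E : Type*} [MeasurableSpace E] {m : Measure E}

theorem smul_nonneg_L1 {c : ℝ} (hc : 0 ≤ c) {u : Lp ℝ 1 m} (hu : 0 ≤ u) : 0 ≤ c • u := by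
  rw [← Lp.coeFn_nonneg] at *
  filter_upwards [hu, Lp.coeFn_smul c u] with x hx hx'
  rw [hx']
  exact mul_nonneg hc hx

instance : IsOrderedModule ℝ (Lp ℝ 1 m) := .of_smul_nonneg fun _ hc _ hu => smul_nonneg_L1 hc hu

/-- The integral as a continuous linear functional on `L¹`. -/
noncomputable def integralL (m : Measure E) : Lp ℝ 1 m →L[ℝ] ℝ := L1.integralCLM

theorem integralL_apply (u : Lp ℝ 1 m) : integralL m u = ∫ x, u x ∂m := by
  rw [← L1.integral_eq_integral, L1.integral_eq]; rfl

theorem norm_eq_integralL {u : Lp ℝ 1 m} (hu : 0 ≤ u) : ‖u‖ = integralL m u := by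
  rw [integralL_apply, L1.norm_eq_integral_norm]
  refine integral_congr_ae ?_
  filter_upwards [(Lp.coeFn_nonneg u).2 hu] with x hx
  exact Real.norm_of_nonneg hx

theorem integralL_nonneg {u : Lp ℝ 1 m} (hu : 0 ≤ u) : 0 ≤ integralL m u :=
  norm_eq_integralL hu ▸ norm_nonneg u

theorem exists_nonneg_sub (u : Lp ℝ 1 m) : ∃ v w : Lp ℝ 1 m, 0 ≤ v ∧ 0 ≤ w ∧ u = v - w ∧
    ‖u‖ = integralL m v + integralL m w := by
  refine ⟨u⁺, u⁻, posPart_nonneg u, negPart_nonneg u, (posPart_sub_negPart u).symm, ?_⟩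
  rw [← norm_abs_eq_norm, norm_eq_integralL (abs_nonneg u), ← posPart_add_negPart, map_add]

theorem eq_of_eq_on_nonneg {Y F : Type*} [AddCommGroup Y] [FunLike F (Lp ℝ 1 m) Y]
    [AddMonoidHomClass F (Lp ℝ 1 m) Y] {C D : F} (h : ∀ u, 0 ≤ u → C u = D u) (u : Lp ℝ 1 m) :
    C u = D u := by
  obtain ⟨v, w, hv, hw, rfl, -⟩ := exists_nonneg_sub u
  rw [map_sub, map_sub, h v hv, h w hw]

/-- The norm is additive on the cone and `‖u‖ = ‖u⁺‖ + ‖u⁻‖`, so a positive operator need only be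
tested on the cone. Continuity is not assumed, so the bound also serves to establish it. -/
theorem norm_apply_le_of_nonneg {F : Type*} [FunLike F (Lp ℝ 1 m) (Lp ℝ 1 m)]
    [AddMonoidHomClass F (Lp ℝ 1 m) (Lp ℝ 1 m)] {C : F} {c : ℝ}
    (hC : ∀ u, 0 ≤ u → 0 ≤ C u) (hc : ∀ u, 0 ≤ u → integralL m (C u) ≤ c * integralL m u)
    (u : Lp ℝ 1 m) : ‖C u‖ ≤ c * ‖u‖ := by
  obtain ⟨v, w, hv, hw, hu, hn⟩ := exists_nonneg_sub u
  rw [hn, mul_add, hu, map_sub]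
  refine (norm_sub_le _ _).trans (add_le_add ?_ ?_)
  · rw [norm_eq_integralL (hC v hv)]; exact hc v hv
  · rw [norm_eq_integralL (hC w hw)]; exact hc w hw

end L1

/-! ### Kato's series and its resolvent identity -/

section Kato

variable {E : Type*} [MeasurableSpace E] {m : Measure E}

theorem norm_pow_smul_le (R T : Lp ℝ 1 m →L[ℝ] Lp ℝ 1 m) {r : ℝ} (hr : r ∈ Set.Icc (0 : ℝ) 1) (n : ℕ) (u : Lp ℝ 1 m) :
    ‖r ^ n • R ((T ^ n) u)‖ ≤ ‖R ((T ^ n) u)‖ := by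
  rw [norm_smul, Real.norm_of_nonneg (pow_nonneg hr.1 n)]
  exact mul_le_of_le_one_left (norm_nonneg _) (pow_le_one₀ hr.1 hr.2)

/-- An index shift. It expresses `K = R (1 - r T)⁻¹` without inverting `1 - r T`, and so remains
available at `r = 1`. -/
theorem apply_sub_smul_of_hasSum {R T : Lp ℝ 1 m →L[ℝ] Lp ℝ 1 m} {r : ℝ} {K : Lp ℝ 1 m →L[ℝ] Lp ℝ 1 m}
    (hK : ∀ u, HasSum (fun n => r ^ n • R ((T ^ n) u)) (K u)) (u : Lp ℝ 1 m) :
    K (u - r • T u) = R u := by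
  have h1 : HasSum (fun n => r ^ (n + 1) • R ((T ^ (n + 1)) u)) (K (r • T u)) := by
    refine (hK (r • T u)).congr_fun fun n => ?_
    rw [map_smul, map_smul, smul_smul, ← pow_succ, pow_succ, pow_succ, mul_apply_eq_comp]
  have h2 := (hasSum_nat_add_iff' 1).2 (hK u)
  have h3 := h1.unique h2
  rw [map_sub, h3]
  simp

/-- Positive operators `R = R(lam, A)` and `T = B R(lam, A)` on `L¹` such that `A + B` preserves
the integral. -/
structure IsKatoPair (lam : ℝ) (R T : Lp ℝ 1 m →L[ℝ] Lp ℝ 1 m) : Prop where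
  pos : 0 < lam
  left_nonneg : ∀ u, 0 ≤ u → 0 ≤ R u
  right_nonneg : ∀ u, 0 ≤ u → 0 ≤ T u
  integral_eq : ∀ u, integralL m (T u) = integralL m u - lam * integralL m (R u)

namespace IsKatoPair

variable {lam : ℝ} {R T : Lp ℝ 1 m →L[ℝ] Lp ℝ 1 m} (h : IsKatoPair lam R T)
include h

theorem norm_le (u : Lp ℝ 1 m) : ‖T u‖ ≤ ‖u‖ := by
  refine (norm_apply_le_of_nonneg h.right_nonneg (c := 1) (fun u hu => ?_) u).trans_eq (one_mul _)
  have := mul_nonneg h.pos.le (integralL_nonneg (h.left_nonneg u hu))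
  rw [h.integral_eq]
  linarith

theorem sum_integral_eq (N : ℕ) (u : Lp ℝ 1 m) :
    lam * ∑ n ∈ Finset.range N, integralL m (R ((T ^ n) u))
      = integralL m u - integralL m ((T ^ N) u) := by
  induction N with
  | zero => simp
  | succ N ih =>
    rw [Finset.sum_range_succ, mul_add, ih, pow_succ', mul_apply_eq_comp, h.integral_eq]
    ring

theorem sum_norm_le (N : ℕ) (u : Lp ℝ 1 m) :
    ∑ n ∈ Finset.range N, ‖R ((T ^ n) u)‖ ≤ lam⁻¹ * ‖u‖ := by
  have key : ∀ v, 0 ≤ v → ∑ n ∈ Finset.range N, ‖R ((T ^ n) v)‖ ≤ lam⁻¹ * integralL m v := by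
    intro v hv
    have e : ∀ n ∈ Finset.range N, ‖R ((T ^ n) v)‖ = integralL m (R ((T ^ n) v)) := fun n _ =>
      norm_eq_integralL (h.left_nonneg _ (pow_apply_nonneg h.right_nonneg n hv))
    rw [Finset.sum_congr rfl e, le_inv_mul_iff₀ h.pos, h.sum_integral_eq]
    linarith [integralL_nonneg (pow_apply_nonneg h.right_nonneg N hv)]
  obtain ⟨v, w, hv, hw, hu, hn⟩ := exists_nonneg_sub u
  rw [hn, mul_add]
  refine le_trans ?_ (add_le_add (key v hv) (key w hw))
  rw [← Finset.sum_add_distrib]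
  refine Finset.sum_le_sum fun n _ => ?_
  rw [hu, map_sub, map_sub]
  exact norm_sub_le _ _

theorem summable_norm (u : Lp ℝ 1 m) : Summable fun n => ‖R ((T ^ n) u)‖ :=
  summable_of_sum_range_le (fun _ => norm_nonneg _) fun N => h.sum_norm_le N u

theorem tsum_norm_le (u : Lp ℝ 1 m) : ∑' n, ‖R ((T ^ n) u)‖ ≤ lam⁻¹ * ‖u‖ :=
  Real.tsum_le_of_sum_range_le (fun _ => norm_nonneg _) fun N => h.sum_norm_le N u

theorem summable_smul {r : ℝ} (hr : r ∈ Set.Icc (0 : ℝ) 1) (u : Lp ℝ 1 m) :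
    Summable fun n => r ^ n • R ((T ^ n) u) :=
  .of_norm_bounded (h.summable_norm u) fun n => norm_pow_smul_le R T hr n u

theorem exists_hasSum {r : ℝ} (hr : r ∈ Set.Icc (0 : ℝ) 1) : ∃ K : Lp ℝ 1 m →L[ℝ] Lp ℝ 1 m,
    (∀ u, HasSum (fun n => r ^ n • R ((T ^ n) u)) (K u)) ∧ ∀ u, ‖K u‖ ≤ lam⁻¹ * ‖u‖ := by
  have hs : ∀ u, HasSum (fun n => r ^ n • R ((T ^ n) u)) (∑' n, r ^ n • R ((T ^ n) u)) :=
    fun u => (h.summable_smul hr u).hasSum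
  have hn : ∀ u, ‖∑' n, r ^ n • R ((T ^ n) u)‖ ≤ lam⁻¹ * ‖u‖ := fun u =>
    (tsum_of_norm_bounded (h.summable_norm u).hasSum fun n => norm_pow_smul_le R T hr n u).trans
      (h.tsum_norm_le u)
  exact ⟨LinearMap.mkContinuous
    { toFun := fun u => ∑' n, r ^ n • R ((T ^ n) u)
      map_add' := fun u v => ((hs u).add (hs v)).unique
        (by simpa only [map_add, smul_add] using hs (u + v)) |>.symm
      map_smul' := fun c u => ((hs u).const_smul c).unique
        (by simpa only [map_smul, smul_comm c] using hs (c • u)) |>.symm } lam⁻¹ hn, hs, hn⟩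

/-- The mass that survives all powers of `T` is exactly the defect of `lam • K` from preserving the
integral. -/
theorem tendsto_integral {K : Lp ℝ 1 m →L[ℝ] Lp ℝ 1 m}
    (hK : ∀ u, HasSum (fun n => R ((T ^ n) u)) (K u)) (u : Lp ℝ 1 m) :
    Tendsto (fun n => integralL m ((T ^ n) u)) atTop
      (𝓝 (integralL m u - lam * integralL m (K u))) := by
  have h1 := (((hK u).mapL (integralL m)).tendsto_sum_nat.const_mul lam).const_sub (integralL m u)
  refine h1.congr fun N => ?_
  rw [h.sum_integral_eq, sub_sub_cancel]

end IsKatoPair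

/-- The families `R(lam, A)` and `B R(lam, A)`, `lam > 0`. -/
structure IsKatoFamily (R T : ℝ → Lp ℝ 1 m →L[ℝ] Lp ℝ 1 m) : Prop where
  resolvent : IsContractionResolvent R
  pair : ∀ lam, 0 < lam → IsKatoPair lam (R lam) (T lam)
  right_eq : ∀ lam mu, 0 < lam → 0 < mu → ∀ u,
    T lam (u + (lam - mu) • R mu u) = T mu u

namespace IsKatoFamily

variable {R T : ℝ → Lp ℝ 1 m →L[ℝ] Lp ℝ 1 m} (h : IsKatoFamily R T)
include h

theorem left_eq {lam mu : ℝ} (hlam : 0 < lam) (hmu : 0 < mu) (u : Lp ℝ 1 m) :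
    R lam (u + (lam - mu) • R mu u) = R mu u := by
  have := congrArg (fun F : Lp ℝ 1 m →L[ℝ] Lp ℝ 1 m => F u) (h.resolvent.sub_eq lam mu hlam hmu)
  simp only [sub_apply, smul_apply, mul_apply_eq_comp] at this
  rw [map_add, map_smul, ← neg_sub mu lam, neg_smul, ← this]
  abel

/-- For `r < 1` the Neumann series `w = ∑ rⁿ T(mu)ⁿ u` itself converges, which may fail at `r = 1`.
Put `x = w + (lam - mu) R(mu) w`. Then `T(lam) x = T(mu) w` and `R(lam) x = R(mu) w = L u`, so `K (x
- r T(lam) x) = R(lam) x` reads `K (u + (lam - mu) L u) = L u`. -/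
theorem perturbed_resolvent_eq {lam mu r : ℝ} (hlam : 0 < lam) (hmu : 0 < mu)
    (hr : r ∈ Set.Ico (0 : ℝ) 1) {K L : Lp ℝ 1 m →L[ℝ] Lp ℝ 1 m}
    (hK : ∀ u, HasSum (fun n => r ^ n • R lam ((T lam ^ n) u)) (K u))
    (hL : ∀ u, HasSum (fun n => r ^ n • R mu ((T mu ^ n) u)) (L u)) (u : Lp ℝ 1 m) :
    K u - L u = (mu - lam) • K (L u) := by
  have hs : Summable fun n => r ^ n • (T mu ^ n) u := by
    refine .of_norm_bounded ((summable_geometric_of_lt_one hr.1 hr.2).mul_right ‖u‖) fun n => ?_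
    rw [norm_smul, Real.norm_of_nonneg (pow_nonneg hr.1 n)]
    exact mul_le_mul_of_nonneg_left (norm_pow_apply_le (h.pair mu hmu).norm_le n u)
      (pow_nonneg hr.1 n)
  obtain ⟨w, hw⟩ := hs
  have hwu : w - r • T mu w = u := by
    have h1 : HasSum (fun n => r ^ (n + 1) • (T mu ^ (n + 1)) u) (r • T mu w) := by
      have h2 := (hw.mapL (T mu)).const_smul r
      simp only [map_smul, smul_smul, ← pow_succ', ← mul_apply_eq_comp] at h2
      exact h2
    have h3 := (hasSum_nat_add_iff' 1).2 hw
    rw [h1.unique h3, Finset.sum_range_one, pow_zero, pow_zero, one_smul, one_apply_eq_self,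
      sub_sub_cancel]
  have hLu : L u = R mu w := by
    have h2 := hw.mapL (R mu)
    simp only [map_smul] at h2
    exact (hL u).unique h2
  have key := apply_sub_smul_of_hasSum hK (w + (lam - mu) • R mu w)
  rw [h.right_eq lam mu hlam hmu, h.left_eq hlam hmu, ← hLu, add_sub_right_comm, hwu, map_add,
    map_smul] at key
  rw [← neg_sub lam mu, neg_smul, sub_eq_iff_eq_add', ← sub_eq_add_neg, eq_sub_iff_add_eq]
  exact key

/-- Kato's resolvent: the sum of `R(lam, A) (B R(lam, A))ⁿ` is the resolvent of the generator
of a contraction semigroup. -/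
theorem exists_resolvent : ∃ K : ℝ → Lp ℝ 1 m →L[ℝ] Lp ℝ 1 m, IsContractionResolvent K ∧
    ∀ lam, 0 < lam → ∀ u, HasSum (fun n => R lam ((T lam ^ n) u)) (K lam u) := by
  have hex : ∀ r lam : ℝ, ∃ K : Lp ℝ 1 m →L[ℝ] Lp ℝ 1 m, r ∈ Set.Icc (0 : ℝ) 1 → 0 < lam →
      (∀ u, HasSum (fun n => r ^ n • R lam ((T lam ^ n) u)) (K u)) ∧
        ∀ u, ‖K u‖ ≤ lam⁻¹ * ‖u‖ := by
    intro r lam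
    by_cases hr : r ∈ Set.Icc (0 : ℝ) 1
    · by_cases hlam : 0 < lam
      · obtain ⟨K, hK⟩ := (h.pair lam hlam).exists_hasSum hr
        exact ⟨K, fun _ _ => hK⟩
      · exact ⟨0, fun _ h => absurd h hlam⟩
    · exact ⟨0, fun h => absurd h hr⟩
  choose K hK using hex
  have h1 : (1 : ℝ) ∈ Set.Icc (0 : ℝ) 1 := ⟨zero_le_one, le_rfl⟩
  have hsum : ∀ lam, 0 < lam → ∀ u, HasSum (fun n => R lam ((T lam ^ n) u)) (K 1 lam u) :=
    fun lam hlam u => by simpa using (hK 1 lam h1 hlam).1 u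
  have hmem : ∀ᶠ r : ℝ in 𝓝[<] 1, r ∈ Set.Ico (0 : ℝ) 1 := by
    filter_upwards [Ico_mem_nhdsLT (zero_lt_one' ℝ)] with r hr using hr
  have hlim : ∀ lam, 0 < lam → ∀ u, Tendsto (fun r => K r lam u) (𝓝[<] 1) (𝓝 (K 1 lam u)) := by
    intro lam hlam u
    have := tendsto_tsum_of_dominated_convergence (𝓕 := 𝓝[<] (1 : ℝ))
      (f := fun r n => r ^ n • R lam ((T lam ^ n) u)) (g := fun n => R lam ((T lam ^ n) u))
      ((h.pair lam hlam).summable_norm u) (fun n => ?_) ?_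
    · rw [(hsum lam hlam u).tsum_eq] at this
      refine this.congr' ?_
      filter_upwards [hmem] with r hr
      exact ((hK r lam ⟨hr.1, hr.2.le⟩ hlam).1 u).tsum_eq
    · have hc : Continuous fun r : ℝ => r ^ n • R lam ((T lam ^ n) u) := by fun_prop
      exact (hc.tendsto' 1 _ (by simp)).mono_left nhdsWithin_le_nhds
    · filter_upwards [hmem] with r hr n
      exact norm_pow_smul_le (R lam) (T lam) ⟨hr.1, hr.2.le⟩ n u
  refine ⟨K 1, ⟨fun lam hlam => (hK 1 lam h1 hlam).2, fun lam mu hlam hmu => ?_, fun u => ?_⟩, hsum⟩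
  · ext1 u
    simp only [sub_apply, smul_apply, mul_apply_eq_comp]
    -- Strong limits pass to products because the outer operators are bounded by `lam⁻¹` uniformly
    -- in `r`.
    have h2 : Tendsto (fun r => K r lam (K r mu u)) (𝓝[<] 1) (𝓝 (K 1 lam (K 1 mu u))) := by
      have h3 : Tendsto (fun r => K r lam (K r mu u - K 1 mu u)) (𝓝[<] 1) (𝓝 0) := by
        have h4 := (tendsto_iff_norm_sub_tendsto_zero.1 (hlim mu hmu u)).const_mul lam⁻¹
        rw [mul_zero] at h4
        refine squeeze_zero_norm' ?_ h4
        filter_upwards [hmem] with r hr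
        exact (hK r lam ⟨hr.1, hr.2.le⟩ hlam).2 _
      have h5 := h3.add (hlim lam hlam (K 1 mu u))
      rw [zero_add] at h5
      refine h5.congr fun r => ?_
      rw [map_sub, sub_add_cancel]
    refine tendsto_nhds_unique ((hlim lam hlam u).sub (hlim mu hmu u))
      ((h2.const_smul (mu - lam)).congr' ?_)
    filter_upwards [hmem] with r hr
    exact (h.perturbed_resolvent_eq hlam hmu hr (hK r lam ⟨hr.1, hr.2.le⟩ hlam).1
      (hK r mu ⟨hr.1, hr.2.le⟩ hmu).1 u).symm
  · have key : ∀ v, 0 ≤ v → Tendsto (fun lam : ℝ => lam • K 1 lam v) atTop (𝓝 v) := by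
      intro v hv
      have hR := h.resolvent.tendsto v
      -- As `0 ≤ R ≤ K` on the cone, the norm of the difference is `lam ∫ K v - lam ∫ R v`. This is
      -- at most `∫ v - lam ∫ R v`, which tends to zero.
      have h2 : Tendsto (fun lam : ℝ => lam • K 1 lam v - lam • R lam v) atTop (𝓝 0) := by
        have h3 := ((integralL m).continuous.tendsto _).comp hR |>.const_sub (integralL m v)
        rw [sub_self] at h3
        refine squeeze_zero_norm' ?_ h3
        filter_upwards [eventually_gt_atTop 0] with lam hlam
        have hp := h.pair lam hlam
        have h4 : R lam v ≤ K 1 lam v := by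
          have := sum_le_hasSum {0} (fun n _ => hp.left_nonneg _
            (pow_apply_nonneg hp.right_nonneg n hv)) (hsum lam hlam v)
          simpa using this
        have h5 : 0 ≤ K 1 lam v := (hp.left_nonneg v hv).trans h4
        have h6 := (hK 1 lam h1 hlam).2 v
        rw [norm_eq_integralL h5, norm_eq_integralL hv, le_inv_mul_iff₀ hlam] at h6
        rw [← smul_sub, norm_eq_integralL (smul_nonneg hlam.le (sub_nonneg.2 h4))]
        simp only [Function.comp, map_smul, map_sub, smul_eq_mul]
        linarith
      simpa using h2.add hR
    obtain ⟨v, w, hv, hw, rfl, -⟩ := exists_nonneg_sub u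
    simpa only [map_sub, smul_sub] using (key v hv).sub (key w hw)

end IsKatoFamily

end Kato

/-! ### Resolvents of substochastic and stochastic semigroups -/

section Substochastic

variable {E : Type*} [MeasurableSpace E] {m : Measure E}

theorem IsSubstochasticSemigroup.exists_resolvent {S : ℝ≥0 → Lp ℝ 1 m →L[ℝ] Lp ℝ 1 m}
    (hS : IsSubstochasticSemigroup S) : ∃ R : ℝ → Lp ℝ 1 m →L[ℝ] Lp ℝ 1 m,
      IsContractionResolvent R ∧ (∀ lam, 0 < lam → ∀ u, 0 ≤ u → 0 ≤ R lam u) ∧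
      (∀ lam, 0 < lam → ∀ u, (R lam u, lam • R lam u - u) ∈ (generator S).graph) ∧
      (∀ lam, 0 < lam → ∀ u v, (u, v) ∈ (generator S).graph → R lam (lam • u - v) = u) ∧
      ∀ t u, Tendsto (fun lam => expSemigroup (yosida R lam) t u) atTop (𝓝 (S t u)) := by
  have hC := hS.toIsC0Semigroup
  have hc := hS.contraction
  refine ⟨_, isContractionResolvent_laplace hC hc, fun lam hlam u hu => ?_, fun lam hlam u => ?_,
    fun lam hlam u v h => ?_, tendsto_expSemigroup_laplace hC hc⟩
  · rw [dif_pos hlam]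
    exact laplace_apply_nonneg hC hc hlam hS.nonneg hu
  · rw [dif_pos hlam]
    exact laplace_mem_graph hC hc hlam u
  · rw [dif_pos hlam]
    exact laplace_of_mem_graph hC hc hlam h

theorem IsSubstochasticSemigroup.isStochasticSemigroup_iff {P : ℝ≥0 → Lp ℝ 1 m →L[ℝ] Lp ℝ 1 m}
    (hP : IsSubstochasticSemigroup P) :
    IsStochasticSemigroup P ↔ ∀ t u, integralL m (P t u) = integralL m u := by
  constructor
  · intro h t u
    refine eq_of_eq_on_nonneg (C := (integralL m).comp (P t)) (D := integralL m) (fun v hv => ?_) u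
    rcases eq_or_ne v 0 with rfl | hv0
    · simp
    have hn : ‖v‖ ≠ 0 := norm_ne_zero_iff.2 hv0
    have hd := h.density t (‖v‖⁻¹ • v) ⟨smul_nonneg (by positivity) hv, by
      rw [norm_smul, norm_inv, norm_norm, inv_mul_cancel₀ hn]⟩
    have h1 := hd.2
    rw [map_smul, norm_smul, norm_inv, norm_norm, inv_mul_eq_one₀ hn,
      norm_eq_integralL hv, norm_eq_integralL (hP.nonneg t v hv)] at h1
    exact h1.symm
  · intro h
    refine ⟨hP.toIsC0Semigroup, fun t u hu => ⟨hP.nonneg t u hu.1, ?_⟩⟩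
    rw [norm_eq_integralL (hP.nonneg t u hu.1), h, ← norm_eq_integralL hu.1, hu.2]

/-- Both sides say that the integral annihilates the range of the generator, which consists of the
vectors `lam • K lam u - u`. Conversely, the integral then annihilates the Yosida approximations, so
their exponentials preserve it. -/
theorem integralL_semigroup_eq_iff {K : ℝ → Lp ℝ 1 m →L[ℝ] Lp ℝ 1 m}
    {P : ℝ≥0 → Lp ℝ 1 m →L[ℝ] Lp ℝ 1 m} (hK : IsContractionResolvent K)
    (hgen : ∀ lam, 0 < lam → ∀ u, (K lam u, lam • K lam u - u) ∈ (generator P).graph)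
    (hlim : ∀ t u, Tendsto (fun lam => expSemigroup (yosida K lam) t u) atTop (𝓝 (P t u)))
    {lam : ℝ} (hlam : 0 < lam) :
    (∀ t u, integralL m (P t u) = integralL m u) ↔
      ∀ u, lam * integralL m (K lam u) = integralL m u := by
  constructor
  · intro h u
    have h1 := ((integralL m).continuous.tendsto _).comp (mem_graph_generator.1 (hgen lam hlam u))
    have h2 : integralL m (lam • K lam u - u) = 0 :=
      tendsto_nhds_unique h1 (tendsto_const_nhds.congr fun t => by simp [h])
    rw [map_sub, map_smul, smul_eq_mul, sub_eq_zero] at h2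
    exact h2
  · intro h t u
    -- The resolvent identity carries the hypothesis from the single `lam` to every `mu`.
    have h1 : ∀ mu, 0 < mu → ∀ v, mu * integralL m (K mu v) = integralL m v := by
      intro mu hmu v
      have h2 := congrArg (fun F : Lp ℝ 1 m →L[ℝ] Lp ℝ 1 m => lam * integralL m (F v))
        (hK.sub_eq lam mu hlam hmu)
      simp only [sub_apply, smul_apply, mul_apply_eq_comp, map_sub, map_smul, smul_eq_mul,
        mul_sub] at h2
      rw [mul_left_comm, h, h] at h2
      linarith
    refine tendsto_nhds_unique (((integralL m).continuous.tendsto _).comp (hlim t u))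
      (tendsto_const_nhds.congr' ?_)
    filter_upwards [eventually_gt_atTop 0] with mu hmu
    have h3 : ∀ v, integralL m (yosida K mu v) = 0 := fun v => by
      simp [yosida, h1 mu hmu v]
    have h4 := (hasSum_exp_apply (yosida K mu) t u).mapL (integralL m)
    have h5 := hasSum_single (f := fun n : ℕ =>
      integralL m (((t : ℝ) ^ n / n.factorial) • (yosida K mu ^ n) u)) 0 fun n hn => by
        obtain ⟨k, rfl⟩ := Nat.exists_eq_succ_of_ne_zero hn
        rw [map_smul, pow_succ' (yosida K mu), mul_apply_eq_comp, h3, smul_zero]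
    have h6 := h5.unique h4
    simp only [pow_zero, Nat.factorial_zero, Nat.cast_one, div_one, one_smul,
      one_apply_eq_self] at h6
    exact h6

end Substochastic

/-! ### Existence and minimality of the perturbed semigroup -/

section Minimal

variable {E : Type*} [MeasurableSpace E] {m : Measure E} {A B : Lp ℝ 1 m →ₗ.[ℝ] Lp ℝ 1 m}

theorem resolvent_shift {A : Lp ℝ 1 m →ₗ.[ℝ] Lp ℝ 1 m} {lam : ℝ} (h : lam ∈ resolventSet A)
    (x : A.domain) : resolvent A lam (shift A lam x) = x := by
  rw [resolvent, dif_pos h]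
  exact (LinearEquiv.ofBijective (shift A lam) h.1).symm_apply_apply x

theorem BR_apply_shift {hAB : A.domain ≤ B.domain} {lam : ℝ} (h : lam ∈ resolventSet A)
    (x : A.domain) : BR A B hAB lam (lam • (x : Lp ℝ 1 m) - A x) = B ⟨x, hAB x.2⟩ := by
  change B.toFun (Submodule.inclusion hAB (resolvent A lam (shift A lam x))) = _
  rw [resolvent_shift h]
  rfl

theorem IsSubstochasticSemigroup.exists_katoFamily {S : ℝ≥0 → Lp ℝ 1 m →L[ℝ] Lp ℝ 1 m}
    (hS : IsSubstochasticSemigroup S) (hA : generator S = A) (hAB : A.domain ≤ B.domain)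
    (hB : ∀ u : A.domain, 0 ≤ (u : Lp ℝ 1 m) → 0 ≤ B ⟨u, hAB u.2⟩)
    (hint : ∀ u : A.domain, 0 ≤ (u : Lp ℝ 1 m) →
      ∫ x, (A u + B ⟨u, hAB u.2⟩ : Lp ℝ 1 m) x ∂m = 0) :
    ∃ R T : ℝ → Lp ℝ 1 m →L[ℝ] Lp ℝ 1 m, IsKatoFamily R T ∧
      (∀ lam, 0 < lam → ∀ u, T lam u = BR A B hAB lam u) ∧
      (∀ lam, 0 < lam → ∀ x : A.domain, R lam (lam • (x : Lp ℝ 1 m) - A x) = x) ∧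
      (∀ lam, 0 < lam → ∀ x : A.domain,
        T lam (lam • (x : Lp ℝ 1 m) - A x) = B ⟨x, hAB x.2⟩) ∧
      ∀ lam, 0 < lam → ∀ u, ∃ x : A.domain, R lam u = x ∧ A x = lam • (x : Lp ℝ 1 m) - u := by
  obtain ⟨R, hR, hRp, hRg, hRl, -⟩ := hS.exists_resolvent
  rw [hA] at hRg hRl
  have hres : ∀ lam, 0 < lam → lam ∈ resolventSet A := fun lam hlam =>
    hA ▸ mem_resolventSet hS.toIsC0Semigroup hS.contraction hlam
  have hx : ∀ lam, 0 < lam → ∀ u, ∃ x : A.domain, R lam u = x ∧ A x = lam • (x : Lp ℝ 1 m) - u := by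
    intro lam hlam u
    obtain ⟨x, hx, hx'⟩ := (LinearPMap.mem_graph_iff _).1 (hRg lam hlam u)
    exact ⟨x, hx.symm, by rw [hx', hx]⟩
  have hBR : ∀ lam, 0 < lam → ∀ u, 0 ≤ u → 0 ≤ BR A B hAB lam u ∧
      integralL m (BR A B hAB lam u) = integralL m u - lam * integralL m (R lam u) := by
    intro lam hlam u hu
    obtain ⟨x, hx, hx'⟩ := hx lam hlam u
    have hx0 : 0 ≤ (x : Lp ℝ 1 m) := hx ▸ hRp lam hlam u hu
    have hu' : u = lam • (x : Lp ℝ 1 m) - A x := by rw [hx', sub_sub_cancel]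
    have hBx : BR A B hAB lam u = B ⟨x, hAB x.2⟩ := by rw [hu', BR_apply_shift (hres lam hlam)]
    have h1 := hint x hx0
    rw [← integralL_apply, map_add, hx', map_sub, map_smul, smul_eq_mul] at h1
    rw [hBx, hx]
    exact ⟨hB x hx0, by linarith⟩
  have hT : ∀ lam, ∃ T : Lp ℝ 1 m →L[ℝ] Lp ℝ 1 m, 0 < lam → ∀ u, T u = BR A B hAB lam u := by
    intro lam
    by_cases hlam : 0 < lam
    · refine ⟨(BR A B hAB lam).mkContinuous 1 ?_, fun _ u => rfl⟩
      refine norm_apply_le_of_nonneg (fun u hu => (hBR lam hlam u hu).1) fun u hu => ?_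
      rw [(hBR lam hlam u hu).2, one_mul]
      linarith [mul_nonneg hlam.le (integralL_nonneg (hRp lam hlam u hu))]
    · exact ⟨0, fun h => absurd h hlam⟩
  choose T hT using hT
  have hTA : ∀ lam, 0 < lam → ∀ x : A.domain,
      T lam (lam • (x : Lp ℝ 1 m) - A x) = B ⟨x, hAB x.2⟩ := fun lam hlam x => by
    rw [hT lam hlam, BR_apply_shift (hres lam hlam)]
  refine ⟨R, T, ⟨hR, fun lam hlam => ⟨hlam, hRp lam hlam, fun u hu => ?_, fun u => ?_⟩,
    fun lam mu hlam hmu u => ?_⟩, hT, fun lam hlam x => hRl lam hlam _ _ (A.mem_graph x), hTA, hx⟩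
  · rw [hT lam hlam]
    exact (hBR lam hlam u hu).1
  · refine eq_of_eq_on_nonneg (C := (integralL m).comp (T lam))
      (D := integralL m - lam • (integralL m).comp (R lam)) (fun v hv => ?_) u
    simpa [hT lam hlam] using (hBR lam hlam v hv).2
  · obtain ⟨x, hx, hx'⟩ := hx mu hmu u
    have h1 : u + (lam - mu) • R mu u = lam • (x : Lp ℝ 1 m) - A x := by
      rw [hx, hx', sub_smul]; abel
    have h2 : u = mu • (x : Lp ℝ 1 m) - A x := by rw [hx', sub_sub_cancel]
    rw [h1, hTA lam hlam, ← hTA mu hmu, ← h2]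

theorem mem_graph_add {hAB : A.domain ≤ B.domain} (x : A.domain) :
    ((x : Lp ℝ 1 m), A x + B ⟨x, hAB x.2⟩) ∈ (A + B).graph :=
  (LinearPMap.mem_graph_iff _).2 ⟨⟨x, x.2, hAB x.2⟩, rfl, rfl⟩

theorem IsMinimalSemigroup.unique {P Q : ℝ≥0 → Lp ℝ 1 m →L[ℝ] Lp ℝ 1 m}
    (hP : IsMinimalSemigroup A B P) (hQ : IsMinimalSemigroup A B Q) : P = Q := by
  funext t
  ext1 u
  exact eq_of_eq_on_nonneg (fun v hv => le_antisymm
    (hP.le Q hQ.substochastic hQ.extension t v hv)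
    (hQ.le P hP.substochastic hP.extension t v hv)) u

/-- **Kato's theorem**: the minimal substochastic semigroup exists, and its resolvent is
`∑ₙ R(lam, A) (B R(lam, A))ⁿ`. -/
theorem exists_isMinimalSemigroup {hAB : A.domain ≤ B.domain}
    {R T : ℝ → Lp ℝ 1 m →L[ℝ] Lp ℝ 1 m} (h : IsKatoFamily R T)
    (hR : ∀ lam, 0 < lam → ∀ x : A.domain, R lam (lam • (x : Lp ℝ 1 m) - A x) = x)
    (hT : ∀ lam, 0 < lam → ∀ x : A.domain, T lam (lam • (x : Lp ℝ 1 m) - A x) = B ⟨x, hAB x.2⟩)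
    (hx : ∀ lam, 0 < lam → ∀ u, ∃ x : A.domain, R lam u = x ∧ A x = lam • (x : Lp ℝ 1 m) - u) :
    ∃ (P : ℝ≥0 → Lp ℝ 1 m →L[ℝ] Lp ℝ 1 m) (K : ℝ → Lp ℝ 1 m →L[ℝ] Lp ℝ 1 m),
      IsMinimalSemigroup A B P ∧ IsContractionResolvent K ∧
      (∀ lam, 0 < lam → ∀ u, HasSum (fun n => R lam ((T lam ^ n) u)) (K lam u)) ∧
      (∀ lam, 0 < lam → ∀ u, (K lam u, lam • K lam u - u) ∈ (generator P).graph) ∧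
      ∀ t u, Tendsto (fun lam => expSemigroup (yosida K lam) t u) atTop (𝓝 (P t u)) := by
  obtain ⟨K, hK, hsum⟩ := h.exists_resolvent
  obtain ⟨P, hP, hPc, hlim, hgen⟩ := hK.exists_semigroup
  have hKp : ∀ lam, 0 < lam → ∀ u, 0 ≤ u → 0 ≤ K lam u := fun lam hlam u hu =>
    (hsum lam hlam u).nonneg fun n => (h.pair lam hlam).left_nonneg _
      (pow_apply_nonneg (h.pair lam hlam).right_nonneg n hu)
  refine ⟨P, K, ⟨⟨hP, fun t u hu => ?_, hPc⟩, ?_, fun Q hQ hext t u hu => ?_⟩, hK, hsum, hgen, hlim⟩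
  · refine ge_of_tendsto (hlim t u) ?_
    filter_upwards [eventually_gt_atTop 0] with lam hlam
    exact expSemigroup_yosida_nonneg hlam (hKp lam hlam) t hu
  · refine LinearPMap.le_of_le_graph ?_
    rintro ⟨u, v⟩ huv
    obtain ⟨y, hy, hy'⟩ := (LinearPMap.mem_graph_iff _).1 huv
    let x : A.domain := ⟨y, y.2.1⟩
    have hv : A x + B ⟨x, hAB x.2⟩ = v := hy'
    have hu : (x : Lp ℝ 1 m) = u := hy
    -- With `R (1 - A) x = x` and `T (1 - A) x = B x`, this says `K (x - A x - B x) = x`, so `x`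
    -- lies in the domain of the generator of `P`.
    have h1 := apply_sub_smul_of_hasSum (r := 1) (K := K 1)
      (by simpa using hsum 1 one_pos) ((1 : ℝ) • (x : Lp ℝ 1 m) - A x)
    rw [hR 1 one_pos, hT 1 one_pos] at h1
    have h2 := hgen 1 one_pos ((1 : ℝ) • (x : Lp ℝ 1 m) - A x - (1 : ℝ) • B ⟨x, hAB x.2⟩)
    rw [h1] at h2
    rw [← hu, ← hv]
    convert h2 using 2
    rw [one_smul, one_smul]
    abel
  · obtain ⟨L, hL, hLp, -, hLl, hLlim⟩ := hQ.exists_resolvent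
    refine le_of_tendsto_of_tendsto (hlim t u) (hLlim t u) ?_
    filter_upwards [eventually_gt_atTop 0] with lam hlam
    refine expSemigroup_yosida_le hlam (hKp lam hlam) (fun w hw => ?_) t hu
    -- Write `w = (lam - A) x`. Since the generator of `Q` extends `A + B`, `L` sends `(lam - A - B)
    -- x = w - T w` to `x = R w`.
    have hstep : ∀ w, L lam w = R lam w + L lam (T lam w) := by
      intro w
      obtain ⟨x, hx1, hx2⟩ := hx lam hlam w
      have hw : w = lam • (x : Lp ℝ 1 m) - A x := by rw [hx2, sub_sub_cancel]
      have h1 := hLl lam hlam _ _ (LinearPMap.le_graph_of_le hext (mem_graph_add (hAB := hAB) x))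
      rw [← hT lam hlam, ← hw, hx2, map_sub, map_add, map_sub, map_smul] at h1
      rw [hx1]
      rw [← h1]
      abel
    have hiter : ∀ N w, L lam w = ∑ n ∈ Finset.range N, R lam ((T lam ^ n) w)
        + L lam ((T lam ^ N) w) := by
      intro N w
      induction N with
      | zero => simp
      | succ N ih =>
        rw [ih, hstep ((T lam ^ N) w), Finset.sum_range_succ, pow_succ' (T lam),
          mul_apply_eq_comp, add_assoc]
    refine le_of_tendsto' (hsum lam hlam w).tendsto_sum_nat fun N => ?_
    rw [hiter N w]
    exact le_add_of_nonneg_right (hLp lam hlam _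
      (pow_apply_nonneg (h.pair lam hlam).right_nonneg N hw))

end Minimal

/-! ### Duality of `L¹` and `L^∞`, and the limit function -/

section Duality

variable {E : Type*} [MeasurableSpace E] {m : Measure E}

/-- The pairing of `L^∞` and `L¹`. -/
noncomputable def pairing (m : Measure E) : Lp ℝ ∞ m →L[ℝ] Lp ℝ 1 m →L[ℝ] ℝ :=
  (ContinuousLinearMap.mul ℝ ℝ).lpPairing m ∞ 1

theorem pairing_apply (f : Lp ℝ ∞ m) (u : Lp ℝ 1 m) : pairing m f u = ∫ x, f x * u x ∂m :=
  (ContinuousLinearMap.mul ℝ ℝ).lpPairing_eq_integral f u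

theorem ae_nonneg_of_forall_pairing_nonneg [SigmaFinite m] {g : Lp ℝ ∞ m}
    (h : ∀ u, 0 ≤ u → 0 ≤ pairing m g u) : ∀ᵐ x ∂m, 0 ≤ g x := by
  have hg := Lp.memLp g
  refine ae_nonneg_of_forall_setIntegral_nonneg_of_sigmaFinite (fun s hs hms => ?_)
    fun s hs hms => ?_
  · have : IsFiniteMeasure (m.restrict s) := ⟨by simpa using hms⟩
    exact (hg.restrict s).integrable le_top
  · have h1 : 0 ≤ (indicatorConstLp 1 hs hms.ne (1 : ℝ)) := by
      rw [← Lp.coeFn_nonneg]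
      filter_upwards [indicatorConstLp_coeFn (p := 1) (hs := hs) (hμs := hms.ne) (c := (1 : ℝ))]
        with x hx
      rw [hx]
      exact Set.indicator_nonneg (fun _ _ => zero_le_one) x
    have h2 := h _ h1
    rw [pairing_apply] at h2
    rw [← integral_indicator hs]
    refine h2.trans_eq (integral_congr_ae ?_)
    filter_upwards [indicatorConstLp_coeFn (p := 1) (hs := hs) (hμs := hms.ne) (c := (1 : ℝ))]
      with x hx
    rw [hx]
    by_cases hxs : x ∈ s <;> simp [hxs]

theorem pairing_injective [SigmaFinite m] : Function.Injective (pairing m) := by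
  refine (injective_iff_map_eq_zero _).2 fun g hg => ?_
  have h1 := ae_nonneg_of_forall_pairing_nonneg (g := g) fun u _ => by simp [hg]
  have h2 := ae_nonneg_of_forall_pairing_nonneg (g := -g) fun u _ => by simp [hg]
  refine Lp.ext ?_
  filter_upwards [h1, h2, Lp.coeFn_neg g, Lp.coeFn_zero ℝ ∞ m] with x hx1 hx2 hx3 hx4
  rw [hx3, Pi.neg_apply] at hx2
  rw [hx4, Pi.zero_apply]
  linarith

theorem exists_pos_integrable (m : Measure E) [SigmaFinite m] :
    ∃ w : E → ℝ, (∀ x, 0 < w x) ∧ Measurable w ∧ Integrable w m := by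
  obtain ⟨w, hw0, hwm, hw⟩ := exists_pos_lintegral_lt_of_sigmaFinite m one_ne_zero
  refine ⟨fun x => w x, fun x => NNReal.coe_pos.2 (hw0 x), hwm.coe_nnreal_real,
    hwm.coe_nnreal_real.aestronglyMeasurable, ?_⟩
  rw [hasFiniteIntegral_iff_enorm]
  simpa using hw.trans ENNReal.one_lt_top

theorem exists_pos_memLp_two (m : Measure E) [SigmaFinite m] :
    ∃ h : E → ℝ, (∀ x, 0 < h x) ∧ Measurable h ∧ MemLp h 2 m := by
  obtain ⟨w, hw0, hwm, hw⟩ := exists_pos_integrable m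
  refine ⟨fun x => √(w x), fun x => Real.sqrt_pos.2 (hw0 x), hwm.sqrt, ?_⟩
  rw [memLp_two_iff_integrable_sq hwm.sqrt.aestronglyMeasurable]
  exact hw.congr (Eventually.of_forall fun x => (Real.sq_sqrt (hw0 x).le).symm)

/-- Multiplication by a fixed element of `L²`, as a map from `L²` to `L¹`. -/
noncomputable def mulL (H : Lp ℝ 2 m) : Lp ℝ 2 m →L[ℝ] Lp ℝ 1 m := (ContinuousLinearMap.mul ℝ ℝ).holderL m 2 2 1 H

theorem coeFn_mulL (H k : Lp ℝ 2 m) : mulL H k =ᵐ[m] fun x => H x * k x :=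
  (ContinuousLinearMap.mul ℝ ℝ).coeFn_holder H k

/-- Truncate `u` to the set where `|u| ≤ n h²`. There `|u / h| ≤ n h` is in `L²`, and these sets
exhaust `E` because `h > 0`. -/
theorem denseRange_mulL {h : E → ℝ} (hpos : ∀ x, 0 < h x) (hm : Measurable h) (h2 : MemLp h 2 m) :
    DenseRange (mulL (h2.toLp h)) := by
  intro u
  have hu := L1.measurable_coeFn u
  set s : ℕ → Set E := fun n => {x | |u x| ≤ n * h x ^ 2}
  have hs : ∀ n, MeasurableSet (s n) := fun n =>
    measurableSet_le (by fun_prop) (by fun_prop)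
  set k : ℕ → E → ℝ := fun n => (s n).indicator fun x => u x / h x
  have hk1 : ∀ n x, x ∈ s n → k n x = u x / h x := fun n x hx => Set.indicator_of_mem hx _
  have hk0 : ∀ n x, x ∉ s n → k n x = 0 := fun n x hx => Set.indicator_of_notMem hx _
  have hkm : ∀ n, Measurable (k n) := fun n => (hu.div hm).indicator (hs n)
  have hk : ∀ n, MemLp (k n) 2 m := fun n => by
    refine h2.of_le_mul (c := n) (hkm n).aestronglyMeasurable (Eventually.of_forall fun x => ?_)
    rw [Real.norm_of_nonneg (hpos x).le]
    by_cases hx : x ∈ s n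
    · rw [hk1 n x hx, Real.norm_eq_abs, abs_div, abs_of_pos (hpos x),
        div_le_iff₀ (hpos x), mul_assoc, ← sq]
      exact hx
    · rw [hk0 n x hx, norm_zero]
      exact mul_nonneg (Nat.cast_nonneg n) (hpos x).le
  have hae : ∀ n, mulL (h2.toLp h) ((hk n).toLp (k n)) =ᵐ[m] (s n).indicator u := fun n => by
    filter_upwards [coeFn_mulL (h2.toLp h) ((hk n).toLp (k n)), h2.coeFn_toLp, (hk n).coeFn_toLp]
      with x hx1 hx2 hx3
    rw [hx1, hx2, hx3]
    by_cases hx : x ∈ s n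
    · rw [hk1 n x hx, Set.indicator_of_mem hx, mul_div_cancel₀ _ (hpos x).ne']
    · rw [hk0 n x hx, Set.indicator_of_notMem hx, mul_zero]
  have hlim : Tendsto (fun n => mulL (h2.toLp h) ((hk n).toLp (k n))) atTop (𝓝 u) := by
    rw [tendsto_iff_norm_sub_tendsto_zero]
    have h3 : Tendsto (fun n => ∫ x, ‖(s n).indicator u x - u x‖ ∂m) atTop (𝓝 (∫ x, (0 : ℝ) ∂m)) := by
      refine tendsto_integral_of_dominated_convergence (fun x => ‖u x‖) (fun n =>
        ((hu.indicator (hs n)).sub hu).norm.aestronglyMeasurable) (L1.integrable_coeFn u).norm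
        (fun n => Eventually.of_forall fun x => ?_) (Eventually.of_forall fun x => ?_)
      · by_cases hx : x ∈ s n <;> simp [hx]
      · obtain ⟨N, hN⟩ := exists_nat_ge (|u x| / h x ^ 2)
        refine tendsto_const_nhds.congr' ?_
        filter_upwards [eventually_ge_atTop N] with n hn
        have hx : x ∈ s n := by
          have : |u x| / h x ^ 2 ≤ n := hN.trans (by exact_mod_cast hn)
          rwa [div_le_iff₀ (pow_pos (hpos x) 2)] at this
        rw [Set.indicator_of_mem hx, sub_self, norm_zero]
    rw [integral_zero] at h3
    refine h3.congr fun n => ?_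
    rw [L1.norm_eq_integral_norm]
    refine integral_congr_ae ?_
    filter_upwards [hae n, Lp.coeFn_sub (mulL (h2.toLp h) ((hk n).toLp (k n))) u] with x hx1 hx2
    rw [hx2, Pi.sub_apply, hx1]
  exact mem_closure_of_tendsto hlim (Eventually.of_forall fun n => ⟨_, rfl⟩)

/-- On a σ-finite measure space, `L^∞` is the dual of `L¹`. -/
theorem pairing_surjective [SigmaFinite m] : Function.Surjective (pairing m) := by
  intro φ
  obtain ⟨h, hpos, hm, h2⟩ := exists_pos_memLp_two m
  set H := h2.toLp h
  -- Riesz representation in `L²` of `k ↦ φ (h k)`. The density sought is `G / h`.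
  set G : Lp ℝ 2 m := (InnerProductSpace.toDual ℝ (Lp ℝ 2 m)).symm (φ.comp (mulL H))
  have hGk : ∀ k : Lp ℝ 2 m, ∫ x, G x * k x ∂m = φ (mulL H k) := fun k => by
    have h3 : inner ℝ G k = φ (mulL H k) := InnerProductSpace.toDual_symm_apply
    rw [← h3, L2.inner_def]
    refine integral_congr_ae (Eventually.of_forall fun x => ?_)
    simp [mul_comm]
  have hGh : Integrable (fun x => G x * h x) m := (Lp.memLp G).integrable_mul h2
  have hh : Integrable (fun x => h x * h x) m := h2.integrable_mul h2
  -- Testing with `k = h` on `s` and zero elsewhere yields `|G h| ≤ ‖φ‖ h²` almost everywhere, so `G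
  -- / h` is bounded by `‖φ‖`.
  have hset : ∀ s, MeasurableSet s → |∫ x in s, G x * h x ∂m| ≤ ∫ x in s, ‖φ‖ * (h x * h x) ∂m := by
    intro s hs
    have hk := h2.indicator hs
    have h3 : φ (mulL H (hk.toLp _)) = ∫ x in s, G x * h x ∂m := by
      rw [← hGk, ← integral_indicator hs]
      refine integral_congr_ae ?_
      filter_upwards [hk.coeFn_toLp] with x hx
      rw [hx]
      by_cases hxs : x ∈ s <;> simp [hxs]
    have h4 : ‖mulL H (hk.toLp _)‖ = ∫ x in s, h x * h x ∂m := by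
      rw [L1.norm_eq_integral_norm, ← integral_indicator hs]
      refine integral_congr_ae ?_
      filter_upwards [coeFn_mulL H (hk.toLp _), h2.coeFn_toLp, hk.coeFn_toLp] with x hx1 hx2 hx3
      rw [hx1, hx2, hx3]
      by_cases hxs : x ∈ s
      · simp [hxs]
      · simp [hxs]
    rw [← h3, integral_const_mul, ← h4]
    exact φ.le_opNorm _
  have hub : (fun x => G x * h x) ≤ᵐ[m] fun x => ‖φ‖ * (h x * h x) :=
    ae_le_of_forall_setIntegral_le hGh (hh.const_mul _) fun s hs _ =>
      (le_abs_self _).trans (hset s hs)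
  have hlb : (fun x => -(G x * h x)) ≤ᵐ[m] fun x => ‖φ‖ * (h x * h x) :=
    ae_le_of_forall_setIntegral_le hGh.neg (hh.const_mul _) fun s hs _ => by
      rw [integral_neg]
      exact (neg_le_abs _).trans (hset s hs)
  have hg : MemLp (fun x => G x / h x) ∞ m := by
    refine memLp_top_of_bound ((Lp.stronglyMeasurable G).measurable.div hm).aestronglyMeasurable ‖φ‖ ?_
    filter_upwards [hub, hlb] with x hx1 hx2
    rw [Real.norm_eq_abs, abs_div, abs_of_pos (hpos x), div_le_iff₀ (hpos x)]
    have hx := hpos x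
    rw [← mul_assoc] at hx1 hx2
    rw [← neg_mul] at hx2
    exact abs_le'.2 ⟨le_of_mul_le_mul_right hx1 hx, le_of_mul_le_mul_right hx2 hx⟩
  refine ⟨hg.toLp _, ?_⟩
  refine DFunLike.coe_injective ((denseRange_mulL hpos hm h2).equalizer
    (pairing m _).continuous φ.continuous (funext fun k => ?_))
  simp only [Function.comp]
  rw [pairing_apply, ← hGk]
  refine integral_congr_ae ?_
  filter_upwards [coeFn_mulL H k, h2.coeFn_toLp, hg.coeFn_toLp] with x hx1 hx2 hx3
  rw [hx1, hx2, hx3]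
  have := (hpos x).ne'
  field_simp

theorem exists_isAdjoint [SigmaFinite m] (T : Lp ℝ 1 m →L[ℝ] Lp ℝ 1 m) :
    ∃ T', IsAdjoint (T : Lp ℝ 1 m →ₗ[ℝ] Lp ℝ 1 m) T' := by
  let e : Lp ℝ ∞ m ≃ₗ[ℝ] (Lp ℝ 1 m →L[ℝ] ℝ) :=
    LinearEquiv.ofBijective (pairing m : Lp ℝ ∞ m →ₗ[ℝ] _) ⟨pairing_injective, pairing_surjective⟩
  let c : (Lp ℝ 1 m →L[ℝ] ℝ) →ₗ[ℝ] (Lp ℝ 1 m →L[ℝ] ℝ) :=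
    { toFun := fun φ => φ.comp T
      map_add' := fun _ _ => rfl
      map_smul' := fun _ _ => rfl }
  refine ⟨e.symm ∘ₗ c ∘ₗ e, fun f u => ?_⟩
  rw [← pairing_apply]
  have h1 : pairing m ((e.symm ∘ₗ c ∘ₗ e) f) = c (e f) := e.apply_symm_apply (c (e f))
  rw [h1]
  exact pairing_apply f (T u)

theorem isAdjoint_adjoint [SigmaFinite m] (T : Lp ℝ 1 m →L[ℝ] Lp ℝ 1 m) :
    IsAdjoint (T : Lp ℝ 1 m →ₗ[ℝ] Lp ℝ 1 m) (adjoint (T : Lp ℝ 1 m →ₗ[ℝ] Lp ℝ 1 m)) := by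
  rw [adjoint, dif_pos (exists_isAdjoint T)]
  exact (exists_isAdjoint T).choose_spec

theorem coe_pow_apply (T : Lp ℝ 1 m →L[ℝ] Lp ℝ 1 m) (n : ℕ) (u : Lp ℝ 1 m) :
    ((T : Lp ℝ 1 m →ₗ[ℝ] Lp ℝ 1 m) ^ n) u = (T ^ n) u := by
  induction n with
  | zero => rfl
  | succ n ih => rw [pow_succ', pow_succ' T, Module.End.mul_apply, ih, mul_apply_eq_comp]; rfl

theorem pairing_adjoint_pow [SigmaFinite m] (T : Lp ℝ 1 m →L[ℝ] Lp ℝ 1 m) (f : Lp ℝ ∞ m) (n : ℕ)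
    (u : Lp ℝ 1 m) :
    pairing m ((adjoint (T : Lp ℝ 1 m →ₗ[ℝ] Lp ℝ 1 m) ^ n) f) u = pairing m f ((T ^ n) u) := by
  induction n generalizing u with
  | zero => rfl
  | succ n ih =>
    rw [pow_succ', pow_succ T, Module.End.mul_apply, mul_apply_eq_comp, ← ih, pairing_apply,
      pairing_apply]
    exact isAdjoint_adjoint T _ u

theorem coeFn_oneLp (m : Measure E) : oneLp m =ᵐ[m] fun _ => (1 : ℝ) :=
  (memLp_top_const (1 : ℝ)).coeFn_toLp

theorem pairing_oneLp (u : Lp ℝ 1 m) : pairing m (oneLp m) u = integralL m u := by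
  rw [pairing_apply, integralL_apply]
  refine integral_congr_ae ?_
  filter_upwards [coeFn_oneLp m] with x hx
  rw [hx, one_mul]

variable [SigmaFinite m] {T : Lp ℝ 1 m →L[ℝ] Lp ℝ 1 m} (hT : ∀ u, 0 ≤ u → 0 ≤ T u)
  (hTI : ∀ u, 0 ≤ u → integralL m (T u) ≤ integralL m u)
include hT hTI

/-- Pairing `T*ⁿ 1` with `u ≥ 0` gives `∫ Tⁿ u`, which is nonnegative and decreases in `n`; testing
on the cone turns this into pointwise inequalities. -/
theorem ae_adjoint_pow_oneLp : ∀ᵐ x ∂m, ∀ n : ℕ,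
    0 ≤ (adjoint (T : Lp ℝ 1 m →ₗ[ℝ] Lp ℝ 1 m) ^ n) (oneLp m) x ∧
    (adjoint (T : Lp ℝ 1 m →ₗ[ℝ] Lp ℝ 1 m) ^ (n + 1)) (oneLp m) x
      ≤ (adjoint (T : Lp ℝ 1 m →ₗ[ℝ] Lp ℝ 1 m) ^ n) (oneLp m) x ∧
    (adjoint (T : Lp ℝ 1 m →ₗ[ℝ] Lp ℝ 1 m) ^ n) (oneLp m) x ≤ 1 := by
  set a : ℕ → Lp ℝ ∞ m := fun n => (adjoint (T : Lp ℝ 1 m →ₗ[ℝ] Lp ℝ 1 m) ^ n) (oneLp m)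
  have ha : ∀ n u, pairing m (a n) u = integralL m ((T ^ n) u) := fun n u => by
    rw [pairing_adjoint_pow, pairing_oneLp]
  have h1 : ∀ n, ∀ᵐ x ∂m, 0 ≤ a n x := fun n => ae_nonneg_of_forall_pairing_nonneg fun u hu => by
    rw [ha]
    exact integralL_nonneg (pow_apply_nonneg hT n hu)
  have h2 : ∀ n, ∀ᵐ x ∂m, a (n + 1) x ≤ a n x := fun n => by
    have h3 : ∀ᵐ x ∂m, 0 ≤ (a n - a (n + 1)) x := ae_nonneg_of_forall_pairing_nonneg fun u hu => by
      rw [map_sub, sub_apply, ha, ha, sub_nonneg, pow_succ', mul_apply_eq_comp]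
      exact hTI _ (pow_apply_nonneg hT n hu)
    filter_upwards [h3, Lp.coeFn_sub (a n) (a (n + 1))] with x hx hx'
    rw [hx', Pi.sub_apply] at hx
    linarith
  filter_upwards [ae_all_iff.2 h1, ae_all_iff.2 h2, coeFn_oneLp m] with x hx1 hx2 hx3 n
  refine ⟨hx1 n, hx2 n, ?_⟩
  have h4 : Antitone fun n => a n x := antitone_nat_of_succ_le hx2
  exact (h4 (Nat.zero_le n)).trans_eq hx3

theorem ae_tendsto_limitFunction : ∀ᵐ x ∂m, Tendsto
    (fun n : ℕ => (adjoint (T : Lp ℝ 1 m →ₗ[ℝ] Lp ℝ 1 m) ^ n) (oneLp m) x) atTop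
      (𝓝 (limitFunction (T : Lp ℝ 1 m →ₗ[ℝ] Lp ℝ 1 m) x)) := by
  filter_upwards [ae_adjoint_pow_oneLp hT hTI] with x hx
  exact tendsto_nhds_limUnder ⟨_, tendsto_atTop_ciInf (antitone_nat_of_succ_le fun n => (hx n).2.1)
    ⟨0, by rintro _ ⟨n, rfl⟩; exact (hx n).1⟩⟩

theorem ae_limitFunction_mem : ∀ᵐ x ∂m,
    limitFunction (T : Lp ℝ 1 m →ₗ[ℝ] Lp ℝ 1 m) x ∈ Set.Icc (0 : ℝ) 1 := by
  filter_upwards [ae_adjoint_pow_oneLp hT hTI, ae_tendsto_limitFunction hT hTI] with x hx hx'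
  exact isClosed_Icc.mem_of_tendsto hx' (Eventually.of_forall fun n => ⟨(hx n).1, (hx n).2.2⟩)

theorem integrable_limitFunction_mul (u : Lp ℝ 1 m) :
    Integrable (fun x => limitFunction (T : Lp ℝ 1 m →ₗ[ℝ] Lp ℝ 1 m) x * u x) m := by
  refine (L1.integrable_coeFn u).bdd_mul (c := 1) (aestronglyMeasurable_of_tendsto_ae atTop
    (fun n => Lp.aestronglyMeasurable _) (ae_tendsto_limitFunction hT hTI)) ?_
  filter_upwards [ae_limitFunction_mem hT hTI] with x hx
  rw [Real.norm_of_nonneg hx.1]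
  exact hx.2

theorem tendsto_integralL_pow (u : Lp ℝ 1 m) :
    Tendsto (fun n => integralL m ((T ^ n) u)) atTop
      (𝓝 (∫ x, limitFunction (T : Lp ℝ 1 m →ₗ[ℝ] Lp ℝ 1 m) x * u x ∂m)) := by
  have h1 : ∀ n, integralL m ((T ^ n) u) = ∫ x,
      (adjoint (T : Lp ℝ 1 m →ₗ[ℝ] Lp ℝ 1 m) ^ n) (oneLp m) x * u x ∂m := fun n => by
    rw [← pairing_oneLp, ← pairing_adjoint_pow, pairing_apply]
  simp only [h1]
  refine tendsto_integral_of_dominated_convergence (fun x => ‖u x‖) (fun n =>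
    (Lp.aestronglyMeasurable _).mul (Lp.aestronglyMeasurable u)) (L1.integrable_coeFn u).norm
    (fun n => ?_) ?_
  · filter_upwards [ae_adjoint_pow_oneLp hT hTI] with x hx
    rw [norm_mul, Real.norm_of_nonneg (hx n).1]
    exact mul_le_of_le_one_left (norm_nonneg _) (hx n).2.2
  · filter_upwards [ae_tendsto_limitFunction hT hTI] with x hx
    exact hx.mul_const _

theorem measure_limitFunction_pos_eq_zero_iff :
    m {x | 0 < limitFunction (T : Lp ℝ 1 m →ₗ[ℝ] Lp ℝ 1 m) x} = 0 ↔
      ∀ᵐ x ∂m, limitFunction (T : Lp ℝ 1 m →ₗ[ℝ] Lp ℝ 1 m) x = 0 := by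
  have h1 : m {x | 0 < limitFunction (T : Lp ℝ 1 m →ₗ[ℝ] Lp ℝ 1 m) x} = 0 ↔
      ∀ᵐ x ∂m, ¬ 0 < limitFunction (T : Lp ℝ 1 m →ₗ[ℝ] Lp ℝ 1 m) x := by
    simp [ae_iff]
  rw [h1]
  constructor <;> intro h <;> filter_upwards [h, ae_limitFunction_mem hT hTI] with x hx hx'
  · exact le_antisymm (not_lt.1 hx) hx'.1
  · rw [hx]; exact lt_irrefl 0

/-- The integral of `f u` is zero with `f ≥ 0` and `u > 0`; one strictly positive `u` therefore
suffices. -/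
theorem ae_limitFunction_eq_zero_of_tendsto {u : Lp ℝ 1 m} (hu : ∀ᵐ x ∂m, 0 < u x)
    (h : Tendsto (fun n => integralL m ((T ^ n) u)) atTop (𝓝 0)) :
    ∀ᵐ x ∂m, limitFunction (T : Lp ℝ 1 m →ₗ[ℝ] Lp ℝ 1 m) x = 0 := by
  have h1 := tendsto_nhds_unique (tendsto_integralL_pow hT hTI u) h
  rw [integral_eq_zero_iff_of_nonneg_ae ?_ (integrable_limitFunction_mul hT hTI u)] at h1
  · filter_upwards [h1, hu] with x hx hx'
    exact (mul_eq_zero.1 hx).resolve_right hx'.ne'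
  · filter_upwards [hu, ae_limitFunction_mem hT hTI] with x hx hx'
    exact mul_nonneg hx'.1 hx.le

theorem tendsto_of_ae_limitFunction_eq_zero
    (h : ∀ᵐ x ∂m, limitFunction (T : Lp ℝ 1 m →ₗ[ℝ] Lp ℝ 1 m) x = 0) (u : Lp ℝ 1 m) :
    Tendsto (fun n => integralL m ((T ^ n) u)) atTop (𝓝 0) := by
  have h1 := tendsto_integralL_pow hT hTI u
  rw [integral_eq_zero_of_ae] at h1
  · exact h1
  · filter_upwards [h] with x hx
    rw [hx, zero_mul, Pi.zero_apply]

end Duality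

/-! ### Mean ergodicity and decay of the powers -/

section MeanErgodic

variable {E : Type*} [MeasurableSpace E] {m : Measure E}

/-- The kernel of `R lam` does not depend on `lam`, and `mu • R mu v` tends to `v`. -/
theorem IsContractionResolvent.eq_zero_of_apply_eq_zero {X : Type*} [NormedAddCommGroup X] [NormedSpace ℝ X]
    {R : ℝ → X →L[ℝ] X} (hR : IsContractionResolvent R) {lam : ℝ} (hlam : 0 < lam) {v : X}
    (hv : R lam v = 0) : v = 0 := by
  refine tendsto_nhds_unique (hR.tendsto v) (tendsto_const_nhds.congr' ?_)
  filter_upwards [eventually_gt_atTop 0] with mu hmu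
  have h := congrArg (fun F : X →L[ℝ] X => F v) (hR.sub_eq mu lam hmu hlam)
  simp only [sub_apply, smul_apply, mul_apply_eq_comp, hv, map_zero, smul_zero, sub_zero] at h
  rw [h, smul_zero]

theorem norm_pow_tendsto_zero {T : Lp ℝ 1 m →L[ℝ] Lp ℝ 1 m} (hT : ∀ u, 0 ≤ u → 0 ≤ T u)
    (h : ∀ u, Tendsto (fun n => integralL m ((T ^ n) u)) atTop (𝓝 0)) (u : Lp ℝ 1 m) :
    Tendsto (fun n => ‖(T ^ n) u‖) atTop (𝓝 0) := by
  obtain ⟨v, w, hv, hw, rfl, -⟩ := exists_nonneg_sub u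
  have h1 := (h v).add (h w)
  rw [add_zero] at h1
  refine squeeze_zero (fun n => norm_nonneg _) (fun n => ?_) h1
  rw [map_sub, ← norm_eq_integralL (pow_apply_nonneg hT n hv),
    ← norm_eq_integralL (pow_apply_nonneg hT n hw)]
  exact norm_sub_le _ _

theorem IsMeanErgodic.of_tendsto_zero {T : Lp ℝ 1 m →L[ℝ] Lp ℝ 1 m} (hT : ∀ u, 0 ≤ u → 0 ≤ T u)
    (h : ∀ u, Tendsto (fun n => integralL m ((T ^ n) u)) atTop (𝓝 0)) :
    IsMeanErgodic (T : Lp ℝ 1 m →ₗ[ℝ] Lp ℝ 1 m) := by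
  intro u
  refine ⟨0, ?_⟩
  simp only [coe_pow_apply]
  exact (tendsto_zero_iff_norm_tendsto_zero.2 (norm_pow_tendsto_zero hT h u)).cesaro_smul

theorem IsKatoFamily.tendsto_zero_of_isMeanErgodic {R T : ℝ → Lp ℝ 1 m →L[ℝ] Lp ℝ 1 m}
    (h : IsKatoFamily R T) {lam : ℝ} (hlam : 0 < lam)
    (hT : IsMeanErgodic (T lam : Lp ℝ 1 m →ₗ[ℝ] Lp ℝ 1 m)) (u : Lp ℝ 1 m) :
    Tendsto (fun n => integralL m ((T lam ^ n) u)) atTop (𝓝 0) := by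
  suffices hpos : ∀ u : Lp ℝ 1 m, 0 ≤ u →
      Tendsto (fun n => integralL m ((T lam ^ n) u)) atTop (𝓝 0) by
    obtain ⟨v, w, hv, hw, rfl, -⟩ := exists_nonneg_sub u
    simpa using (hpos v hv).sub (hpos w hw)
  intro u hu
  have hp := h.pair lam hlam
  obtain ⟨K, -, hK⟩ := h.exists_resolvent
  have hlim := hp.tendsto_integral (hK lam hlam) u
  set a := integralL m u - lam * integralL m (K lam u)
  obtain ⟨v, hv⟩ := hT u
  simp only [coe_pow_apply] at hv
  have hTv : T lam v = v := by
    -- Applying `T - 1` to the averages telescopes to this expression, so their limit is fixed by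
    -- `T`.
    have h1 : Tendsto (fun N : ℕ => (N : ℝ)⁻¹ • ((T lam ^ N) u - u)) atTop (𝓝 0) := by
      have h2 : Tendsto (fun N : ℕ => (N : ℝ)⁻¹ * (2 * ‖u‖)) atTop (𝓝 0) := by
        simpa using tendsto_inv_atTop_nhds_zero_nat.mul_const (2 * ‖u‖)
      refine squeeze_zero_norm (fun N => ?_) h2
      rw [norm_smul, norm_inv, Real.norm_of_nonneg (Nat.cast_nonneg N)]
      refine mul_le_mul_of_nonneg_left ?_ (by positivity)
      linarith [norm_sub_le ((T lam ^ N) u) u, norm_pow_apply_le hp.norm_le N u]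
    refine sub_eq_zero.1 (tendsto_nhds_unique ((((T lam).continuous.tendsto v).comp hv).sub hv)
      (h1.congr fun N => ?_))
    simp only [Function.comp, map_smul, map_sum, ← smul_sub, ← Finset.sum_sub_distrib]
    congr 1
    rw [eq_comm]
    simpa only [pow_succ' (T lam), mul_apply_eq_comp, pow_zero, one_apply_eq_self] using
      Finset.sum_range_sub (fun n => (T lam ^ n) u) N
  have hIR : lam * integralL m (R lam v) = 0 := by
    have := hp.integral_eq v
    rw [hTv] at this
    linarith
  have hv0 : 0 ≤ v := ge_of_tendsto' hv fun N => smul_nonneg (by positivity)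
    (Finset.sum_nonneg fun n _ => pow_apply_nonneg hp.right_nonneg n hu)
  have hRv : R lam v = 0 := by
    rw [← norm_eq_zero, norm_eq_integralL (hp.left_nonneg v hv0)]
    exact (mul_eq_zero.1 hIR).resolve_left hlam.ne'
  have h3 := ((integralL m).continuous.tendsto v).comp hv
  rw [h.resolvent.eq_zero_of_apply_eq_zero hlam hRv, map_zero] at h3
  -- The Cesàro means of `∫ Tⁿ u` tend to `a`, and they are the integrals of the averages, which
  -- tend to zero.
  have h4 : a = 0 := tendsto_nhds_unique hlim.cesaro_smul (h3.congr fun N => by simp)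
  rwa [h4] at hlim

end MeanErgodic

end KatoVoigt

/-! ### The equivalence theorem -/

theorem theorem3p2 {E : Type*} [MeasurableSpace E] (m : MeasureTheory.Measure E)
    [MeasureTheory.SigmaFinite m]
    (A B : Lp ℝ 1 m →ₗ.[ℝ] Lp ℝ 1 m)
    -- `A` generates a substochastic semigroup
    (hA : ∃ S : ℝ≥0 → Lp ℝ 1 m →L[ℝ] Lp ℝ 1 m,
      KatoVoigt.IsSubstochasticSemigroup S ∧ KatoVoigt.generator S = A)
    -- `D(A) ⊆ D(B)`, and `B u ≥ 0` for `u` in the positive cone of `D(A)`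
    (hAB : A.domain ≤ B.domain)
    (hB : ∀ u : A.domain, 0 ≤ (u : Lp ℝ 1 m) → 0 ≤ B ⟨u, hAB u.2⟩)
    -- the integral of `A u + B u` vanishes for `u` in the positive cone of `D(A)`
    (hint : ∀ u : A.domain, 0 ≤ (u : Lp ℝ 1 m) →
      ∫ x, (A u + B ⟨u, hAB u.2⟩ : Lp ℝ 1 m) x ∂m = 0)
    (lam : ℝ) (hlam : 0 < lam) :
    -- the resolvent, the adjoint, the limit function and the minimal semigroup exist
    lam ∈ KatoVoigt.resolventSet A ∧
    KatoVoigt.IsAdjoint (KatoVoigt.BR A B hAB lam)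
      (KatoVoigt.adjoint (KatoVoigt.BR A B hAB lam)) ∧
    (∀ᵐ x ∂m, Tendsto
      (fun n : ℕ => ((KatoVoigt.adjoint (KatoVoigt.BR A B hAB lam)) ^ n) (KatoVoigt.oneLp m) x)
      atTop (𝓝 (KatoVoigt.limitFunction (KatoVoigt.BR A B hAB lam) x))) ∧
    (∃! P : ℝ≥0 → Lp ℝ 1 m →L[ℝ] Lp ℝ 1 m, KatoVoigt.IsMinimalSemigroup A B P) ∧
    -- the four equivalent conditions
    ∀ P : ℝ≥0 → Lp ℝ 1 m →L[ℝ] Lp ℝ 1 m, KatoVoigt.IsMinimalSemigroup A B P →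
      List.TFAE [
        KatoVoigt.IsStochasticSemigroup P,
        KatoVoigt.IsMeanErgodic (KatoVoigt.BR A B hAB lam),
        m {x | 0 < KatoVoigt.limitFunction (KatoVoigt.BR A B hAB lam) x} = 0,
        ∃ u : Lp ℝ 1 m, 0 ≤ u ∧ (∀ᵐ x ∂m, 0 < u x) ∧
          Tendsto (fun n : ℕ => ‖((KatoVoigt.BR A B hAB lam) ^ n) u‖) atTop (𝓝 0)] := by
  open KatoVoigt in
  obtain ⟨S, hS, hSA⟩ := hA
  obtain ⟨R, T, hKato, hTBR, hRA, hTA, hRx⟩ := hS.exists_katoFamily hSA hAB hB hint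
  obtain ⟨P₀, K, hP₀, hK, hsum, hgen, hlim⟩ := exists_isMinimalSemigroup hKato hRA hTA hRx
  have hp := hKato.pair lam hlam
  have hBR : BR A B hAB lam = (T lam : Lp ℝ 1 m →ₗ[ℝ] Lp ℝ 1 m) :=
    LinearMap.ext fun u => (hTBR lam hlam u).symm
  have hT := hp.right_nonneg
  have hTI : ∀ u, 0 ≤ u → integralL m (T lam u) ≤ integralL m u := fun u hu => by
    rw [hp.integral_eq]
    linarith [mul_nonneg hlam.le (integralL_nonneg (hp.left_nonneg u hu))]
  rw [hBR]
  refine ⟨hSA ▸ mem_resolventSet hS.toIsC0Semigroup hS.contraction hlam, isAdjoint_adjoint _,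
    ae_tendsto_limitFunction hT hTI, ⟨P₀, hP₀, fun Q hQ => hQ.unique hP₀⟩, fun P hP => ?_⟩
  obtain rfl := hP.unique hP₀
  simp only [coe_pow_apply]
  -- The criterion through which the other three conditions are linked to stochasticity.
  have h1 : IsStochasticSemigroup P ↔
      ∀ u, Tendsto (fun n => integralL m ((T lam ^ n) u)) atTop (𝓝 0) := by
    rw [hP.substochastic.isStochasticSemigroup_iff, integralL_semigroup_eq_iff hK hgen hlim hlam]
    refine forall_congr' fun u => ?_
    have h2 := hp.tendsto_integral (hsum lam hlam) u
    constructor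
    · intro h3
      rwa [h3, sub_self] at h2
    · intro h3
      linarith [tendsto_nhds_unique h2 h3]
  rw [measure_limitFunction_pos_eq_zero_iff hT hTI]
  tfae_have 1 → 2 := fun h => .of_tendsto_zero hT (h1.1 h)
  tfae_have 2 → 1 := fun h => h1.2 (hKato.tendsto_zero_of_isMeanErgodic hlam h)
  tfae_have 3 → 1 := fun h => h1.2 (tendsto_of_ae_limitFunction_eq_zero hT hTI h)
  tfae_have 1 → 4 := fun h => by
    obtain ⟨w, hw0, -, hw⟩ := exists_pos_integrable m
    refine ⟨hw.toL1 w, ?_, ?_, norm_pow_tendsto_zero hT (h1.1 h) _⟩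
    · rw [← Lp.coeFn_nonneg]
      filter_upwards [hw.coeFn_toL1] with x hx
      rw [hx]
      exact (hw0 x).le
    · filter_upwards [hw.coeFn_toL1] with x hx
      rw [hx]
      exact hw0 x
  tfae_have 4 → 3 := by
    rintro ⟨u, hu, hu0, h⟩
    refine ae_limitFunction_eq_zero_of_tendsto hT hTI hu0 (h.congr fun n => ?_)
    exact norm_eq_integralL (pow_apply_nonneg hT n hu)
  tfae_finish
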